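/- Let $n\ge 1$, $2<p<\infty$, $\gamma\ge 0$, and put $\alpha=\frac{p-2}{p+n}$, $\beta=\frac{n+2}{p+n}$. Let $\Omega\subset\mathbb R^n$ be a bounded domain satisfying the exterior sphere condition: for every $y\in\partial\Omega$ there is a ball $B_\delta(z)\subset\mathbb R^n\setminus\Omega$ with $\delta>0$ and $y\in\partial B_\delta(z)$. For $\varepsilon>0$ let $\Gamma_\varepsilon=\{x\in\mathbb R^n\setminus\Omega:\operatorname{dist}(x,\partial\Omega)\le\varepsilon\}$. Fix $\varepsilon_0>0$ and let $F\in C^1(\Gamma_{\varepsilon_0})$ satisfy $|F(x)-F(z)|\le L|x-z|$ for all $x,z\in\Gamma_{\varepsilon_0}$ and some constant $L$. For every $0<\varepsilon\le\varepsilon_0$ with $\gamma\varepsilon^2<\frac12$ let $u_\varepsilon:\Omega\cup\Gamma_\varepsilon\to\mathbb R$ be the bounded Borel function with $u_\varepsilon=F$ on $\Gamma_\varepsilon$ that satisfies the dynamic programming principle $$u_\varepsilon(x)=(1-\gamma\varepsilon^2)\Big\{\frac{\alpha}{2}\Big(\sup_{B_\varepsilon(x)}u_\varepsilon+\inf_{B_\varepsilon(x)}u_\varepsilon\Big)+\frac{\beta}{|B_\varepsilon(x)|}\int_{B_\varepsilon(x)}u_\varepsilon(y)\,dy\Big\}\qquad\text{for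 all }x\in\Omega .$$ Then every sequence of numbers in $(0,\varepsilon_0]$ that tends to $0$ has a subsequence $(\varepsilon_j)$ such that $u_{\varepsilon_j}$ converges, uniformly on $\overline\Omega$, to a function $u\in C(\overline\Omega)$ with $u=F$ on $\partial\Omega$ which is a viscosity solution of $$\Delta_p^N u-2(p+n)\gamma u=0\quad\text{in }\Omega .$$ Here $\Delta_p^N\varphi=\Delta\varphi+(p-2)\frac{\langle D^2\varphi\,D\varphi,D\varphi\rangle}{|D\varphi|^2}$ where $D\varphi\neq0$, and viscosity solution means the following, with $c=2(p+n)\gamma$. Whenever $\varphi\in C^2(\Omega)$ touches $u$ from above at $x_0\in\Omega$ (that is, $\varphi(x_0)=u(x_0)$ and $\varphi\ge u$ near $x_0$), then $\Delta_p^N\varphi(x_0)\ge c\,\varphi(x_0)$ if $D\varphi(x_0)\ne0$, and $\lambda_{\max}((p-2)D^2\varphi(x_0))+\Delta\varphi(x_0)\ge c\,\varphi(x_0)$ if $D\varphi(x_0)=0$. Whenever $\varphi\in C^2(\Omega)$ touches $u$ from below at $x_0\in\Omega$ (that is, $\varphi(x_0)=u(x_0)$ and $\varphi\le u$ near $x_0$),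 then $\Delta_p^N\varphi(x_0)\le c\,\varphi(x_0)$ if $D\varphi(x_0)\ne0$, and $\lambda_{\min}((p-2)D^2\varphi(x_0))+\Delta\varphi(x_0)\le c\,\varphi(x_0)$ if $D\varphi(x_0)=0$. The numbers $\lambda_{\max}(X)$ and $\lambda_{\min}(X)$ are the largest and the smallest eigenvalue of the symmetric matrix $X$. -/

import Mathlib

open Set Filter Topology MeasureTheory

noncomputable section

namespace DiscountedTugOfWar

/-- `ℝⁿ` with its Euclidean norm. -/
abbrev E (n : ℕ) : Type := EuclideanSpace ℝ (Fin n)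

/-- The outer boundary strip `Γ_ε = {x ∈ ℝⁿ ∖ Ω : dist(x, ∂Ω) ≤ ε}`. -/
def strip {n : ℕ} (Ω : Set (E n)) (ε : ℝ) : Set (E n) :=
  {x | x ∉ Ω ∧ Metric.infDist x (frontier Ω) ≤ ε}

/-- Exterior sphere condition: every boundary point lies on the boundary of an open ball of
positive radius that is contained in the complement of `Ω`. -/
def ExteriorSphere {n : ℕ} (Ω : Set (E n)) : Prop :=
  ∀ y ∈ frontier Ω, ∃ (z : E n) (δ : ℝ),
    0 < δ ∧ Metric.ball z δ ⊆ Ωᶜ ∧ y ∈ Metric.sphere z δ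

/-- `v` is a bounded Borel function on `Ω_ε = Ω ∪ Γ_ε` with `v = F` on `Γ_ε` that satisfies in `Ω`
the dynamic programming principle with weights `α = (p-2)/(p+n)`, `β = (n+2)/(p+n)` and discount
factor `1 - γ ε²`. For `x ∈ Ω` the ball `B_ε(x)` lies in `Ω_ε`, so only the values of `v` on
`Ω_ε` matter. -/
structure IsDPPSolution {n : ℕ} (Ω : Set (E n)) (p γ ε : ℝ) (F v : E n → ℝ) : Prop where
  measurable : Measurable fun x : ↥(Ω ∪ strip Ω ε) => v x
  bounded : ∃ M : ℝ, ∀ x ∈ Ω ∪ strip Ω ε, |v x| ≤ M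
  boundary : ∀ x ∈ strip Ω ε, v x = F x
  dpp : ∀ x ∈ Ω,
    v x = (1 - γ * ε ^ 2) *
      ((p - 2) / (p + n) / 2 *
          (sSup (v '' Metric.ball x ε) + sInf (v '' Metric.ball x ε)) +
        (n + 2) / (p + n) * ⨍ y in Metric.ball x ε, v y)

/-- The Hessian matrix `D²φ(x)`. -/
def hessian {n : ℕ} (φ : E n → ℝ) (x : E n) : Matrix (Fin n) (Fin n) ℝ :=
  Matrix.of fun i j =>
    iteratedFDeriv ℝ 2 φ x ![EuclideanSpace.single i 1, EuclideanSpace.single j 1]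

/-- Largest eigenvalue of a symmetric matrix. -/
def lambdaMax {n : ℕ} (X : Matrix (Fin n) (Fin n) ℝ) : ℝ := sSup (spectrum ℝ X)

/-- Smallest eigenvalue of a symmetric matrix. -/
def lambdaMin {n : ℕ} (X : Matrix (Fin n) (Fin n) ℝ) : ℝ := sInf (spectrum ℝ X)

/-- The normalized `p`-Laplacian
`Δ_p^N φ = Δφ + (p-2) ⟨D²φ Dφ, Dφ⟩ / |Dφ|²`, used only where `Dφ ≠ 0`. -/
def normPLaplacian {n : ℕ} (p : ℝ) (φ : E n → ℝ) (x : E n) : ℝ :=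
  Laplacian.laplacian φ x +
    (p - 2) * (iteratedFDeriv ℝ 2 φ x ![gradient φ x, gradient φ x] / ‖gradient φ x‖ ^ 2)

/-- Viscosity solutions `u ∈ C(Ω)` of `Δ_p^N u - c u = 0` in the open set `Ω`. -/
structure IsViscositySolution {n : ℕ} (Ω : Set (E n)) (p c : ℝ) (u : E n → ℝ) : Prop where
  continuousOn : ContinuousOn u Ω
  above : ∀ (φ : E n → ℝ) (x₀ : E n), x₀ ∈ Ω → ContDiffOn ℝ 2 φ Ω →
    φ x₀ = u x₀ → (∀ᶠ x in 𝓝 x₀, u x ≤ φ x) →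
    (gradient φ x₀ ≠ 0 → c * φ x₀ ≤ normPLaplacian p φ x₀) ∧
    (gradient φ x₀ = 0 →
      c * φ x₀ ≤ lambdaMax ((p - 2) • hessian φ x₀) + Laplacian.laplacian φ x₀)
  below : ∀ (φ : E n → ℝ) (x₀ : E n), x₀ ∈ Ω → ContDiffOn ℝ 2 φ Ω →
    φ x₀ = u x₀ → (∀ᶠ x in 𝓝 x₀, φ x ≤ u x) →
    (gradient φ x₀ ≠ 0 → normPLaplacian p φ x₀ ≤ c * φ x₀) ∧
    (gradient φ x₀ = 0 →
      lambdaMin ((p - 2) • hessian φ x₀) + Laplacian.laplacian φ x₀ ≤ c * φ x₀)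

end DiscountedTugOfWar

end

/-! For smooth `φ` with `Dφ ≠ 0`, half the sum of supremum and infimum over `B_ε` picks up `ε²/2`
times the second derivative in the gradient direction, while the mean picks up `ε²/(2(n+2)) Δφ`.
With the given weights the game operator is therefore `φ + ε²/(2(p+n)) Δ_p^N φ + o(ε²)`; the
discount removes `γ ε² φ`, and dividing by `ε²` leads to `Δ_p^N u = 2(p+n) γ u`.

Compactness. The functions `v_ε` may be discontinuous, so an asymptotic version of Arzelà–Ascoli is
used (`exists_subseq_tendstoUniformlyOn`). Everything it needs comes from the discrete comparison
principle `comparison`. Comparison with constants bounds `v_ε`. Comparison with the radial function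
`a - C|y - z|^(-2k)`, a strict supersolution by `gameOp_barrier_le`, gives a boundary modulus
independent of `ε` (`boundary_upper`). Comparison of `v_ε` with its own translates carries that
modulus inside (`equicontinuity_upper`).

Limit equation. By Taylor expansion a test function may be replaced by a quadratic polynomial
touching strictly. At an almost maximum point of `v_ε - P`, monotonicity of the game operator yields
a discrete inequality in which the second derivative is evaluated at a maximizing direction `ν` of
the closed unit ball (`approx_inequality`). If the gradient is nonzero, `ν` tends to its direction.
If it vanishes, an upper bound `μ ≥ 0` for the Hessian suffices, whereas for `μ < 0` the possibility
`|ν| < 1` spoils the estimate and the polynomial is tilted to reach a nearby point with nonzero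
gradient (`strict_of_neg`). Tests from below follow by changing signs. -/

noncomputable section

namespace DiscountedTugOfWar

/-! ### Averages of quadratic polynomials over balls -/

section Averages

variable {n : ℕ}

theorem setIntegral_ball_comp_isometry (f : E n ≃ₗᵢ[ℝ] E n) (g : E n → ℝ) (r : ℝ) :
    ∫ h in Metric.ball (0 : E n) r, g (f h) = ∫ h in Metric.ball (0 : E n) r, g h := by
  have h := f.measurePreserving.setIntegral_preimage_emb
    f.toHomeomorph.measurableEmbedding g (Metric.ball 0 r)
  have hp : (f : E n → E n) ⁻¹' Metric.ball 0 r = Metric.ball 0 r := by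
    ext y; simp
  rwa [hp] at h

theorem setIntegral_ball_sub_center (g : E n → ℝ) (x : E n) (r : ℝ) :
    ∫ y in Metric.ball x r, g (y - x) = ∫ h in Metric.ball (0 : E n) r, g h := by
  have h := (measurePreserving_sub_right (volume : Measure (E n)) x).setIntegral_preimage_emb
    (MeasurableEquiv.subRight x).measurableEmbedding g (Metric.ball 0 r)
  have hp : (fun y : E n => y - x) ⁻¹' Metric.ball 0 r = Metric.ball x r := by
    ext y; simp [dist_eq_norm]
  rwa [hp] at h

theorem continuous_integrableOn_ball {g : E n → ℝ} (hg : Continuous g) (x : E n) (r : ℝ) :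
    IntegrableOn g (Metric.ball x r) :=
  (hg.continuousOn.integrableOn_compact (isCompact_closedBall x r)).mono_set
    Metric.ball_subset_closedBall

theorem setIntegral_ball_inner (ξ : E n) (r : ℝ) :
    ∫ h in Metric.ball (0 : E n) r, inner ℝ ξ h = 0 := by
  have h := setIntegral_ball_comp_isometry (LinearIsometryEquiv.neg ℝ)
    (fun h : E n => (inner ℝ ξ h : ℝ)) r
  simp only [LinearIsometryEquiv.coe_neg, inner_neg_right, integral_neg] at h
  linarith

/-- Reflection in the hyperplane orthogonal to `b - c` swaps `b` and `c` and preserves the ball. -/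
theorem setIntegral_ball_inner_sq (b c : E n) (hbc : ‖b‖ = ‖c‖) (r : ℝ) :
    ∫ h in Metric.ball (0 : E n) r, (inner ℝ b h : ℝ) ^ 2 =
      ∫ h in Metric.ball (0 : E n) r, (inner ℝ c h : ℝ) ^ 2 := by
  have h := setIntegral_ball_comp_isometry (ℝ ∙ (b - c))ᗮ.reflection
    (fun h : E n => (inner ℝ c h : ℝ) ^ 2) r
  rw [← h]
  refine setIntegral_congr_fun measurableSet_ball fun y _ => ?_
  have h1 := (ℝ ∙ (b - c))ᗮ.reflection.inner_map_map b y
  rw [Submodule.reflection_sub hbc] at h1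
  rw [h1]

theorem volume_real_ball (hn : 1 ≤ n) (x : E n) {r : ℝ} (hr : 0 ≤ r) :
    (volume : Measure (E n)).real (Metric.ball x r) =
      r ^ n * (volume : Measure (E n)).real (Metric.ball 0 1) := by
  have : Nonempty (Fin n) := ⟨⟨0, hn⟩⟩
  have : Nontrivial (E n) := inferInstance
  rw [measureReal_def, Measure.addHaar_ball _ x hr, ENNReal.toReal_mul,
    ENNReal.toReal_ofReal (by positivity)]
  simp [measureReal_def]

theorem volume_real_ball_pos (x : E n) {r : ℝ} (hr : 0 < r) :
    0 < (volume : Measure (E n)).real (Metric.ball x r) :=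
  ENNReal.toReal_pos (Metric.measure_ball_pos _ _ hr).ne' measure_ball_lt_top.ne

theorem setIntegral_ball_norm_sq (hn : 1 ≤ n) {r : ℝ} (hr : 0 ≤ r) :
    ∫ h in Metric.ball (0 : E n) r, ‖h‖ ^ 2 =
      n * r ^ 2 / (n + 2) * (volume : Measure (E n)).real (Metric.ball 0 r) := by
  have : Nonempty (Fin n) := ⟨⟨0, hn⟩⟩
  have : Nontrivial (E n) := inferInstance
  have h := integral_fun_norm_addHaar (volume : Measure (E n))
    ((Iio r).indicator fun t : ℝ => t ^ 2)
  have h1 : (fun x : E n => (Iio r).indicator (fun t : ℝ => t ^ 2) ‖x‖) =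
      (Metric.ball 0 r).indicator fun x => ‖x‖ ^ 2 := by
    ext x; simp [indicator]
  rw [h1, integral_indicator measurableSet_ball] at h
  rw [h, volume_real_ball hn 0 hr]
  have h2 : ∫ y in Ioi (0 : ℝ), y ^ (Module.finrank ℝ (E n) - 1) •
      (Iio r).indicator (fun t : ℝ => t ^ 2) y = r ^ (n + 2) / (n + 2) := by
    have h3 : (fun y : ℝ => y ^ (Module.finrank ℝ (E n) - 1) •
        (Iio r).indicator (fun t : ℝ => t ^ 2) y) = (Iio r).indicator fun y => y ^ (n + 1) := by
      ext y
      by_cases hy : y ∈ Iio r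
      · rw [indicator_of_mem hy, indicator_of_mem hy, finrank_euclideanSpace_fin, smul_eq_mul,
          ← pow_add]
        congr 1; omega
      · rw [indicator_of_notMem hy, indicator_of_notMem hy, smul_zero]
    rw [h3, setIntegral_indicator measurableSet_Iio, Ioi_inter_Iio,
      ← integral_Ioc_eq_integral_Ioo, ← intervalIntegral.integral_of_le hr, integral_pow]
    push_cast; ring
  rw [h2]
  simp only [finrank_euclideanSpace_fin, nsmul_eq_mul, smul_eq_mul]
  ring

/-- All unit directions give the same integral, and over an orthonormal basis they sum to the
integral of `‖h‖²`, so each is `1/n` of it. -/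
theorem setIntegral_ball_unit_inner_sq (hn : 1 ≤ n) {b : E n} (hb : ‖b‖ = 1) {r : ℝ}
    (hr : 0 ≤ r) :
    ∫ h in Metric.ball (0 : E n) r, (inner ℝ b h : ℝ) ^ 2 =
      r ^ 2 / (n + 2) * (volume : Measure (E n)).real (Metric.ball 0 r) := by
  have h1 := setIntegral_ball_norm_sq hn hr
  have h2 : ∫ h in Metric.ball (0 : E n) r, ‖h‖ ^ 2 =
      ∑ i, ∫ h in Metric.ball (0 : E n) r,
        (inner ℝ (EuclideanSpace.basisFun (Fin n) ℝ i) h : ℝ) ^ 2 := by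
    rw [← integral_finsetSum]
    · refine setIntegral_congr_fun measurableSet_ball fun y _ => ?_
      exact ((EuclideanSpace.basisFun (Fin n) ℝ).sum_sq_inner_right y).symm
    · intro i _
      exact continuous_integrableOn_ball (by fun_prop) 0 r
  rw [h2, Finset.sum_congr rfl fun i _ => setIntegral_ball_inner_sq _ b
    (by rw [hb]; exact (EuclideanSpace.basisFun (Fin n) ℝ).norm_eq_one i) r] at h1
  simp only [Finset.sum_const, Finset.card_univ, Fintype.card_fin, nsmul_eq_mul] at h1
  have hn' : (n : ℝ) ≠ 0 := by positivity
  apply mul_left_cancel₀ hn'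
  rw [h1]; ring

theorem inner_apply_self_eq_sum {A : E n →L[ℝ] E n}
    (hA : (A : E n →ₗ[ℝ] E n).IsSymmetric) (hf : Module.finrank ℝ (E n) = n) (h : E n) :
    (inner ℝ (A h) h : ℝ) =
      ∑ i, hA.eigenvalues hf i * (inner ℝ (hA.eigenvectorBasis hf i) h : ℝ) ^ 2 := by
  rw [← (hA.eigenvectorBasis hf).sum_inner_mul_inner (A h) h]
  refine Finset.sum_congr rfl fun i _ => ?_
  have h1 := hA h (hA.eigenvectorBasis hf i)
  have h2 := hA.apply_eigenvectorBasis hf i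
  simp only [ContinuousLinearMap.coe_coe] at h1 h2
  rw [h1, h2, inner_smul_right, real_inner_comm]
  simp only [RCLike.ofReal_real_eq_id, id]
  ring

theorem setIntegral_ball_quadratic (hn : 1 ≤ n) {A : E n →L[ℝ] E n}
    (hA : (A : E n →ₗ[ℝ] E n).IsSymmetric) {r : ℝ} (hr : 0 ≤ r) :
    ∫ h in Metric.ball (0 : E n) r, (inner ℝ (A h) h : ℝ) =
      r ^ 2 / (n + 2) * LinearMap.trace ℝ (E n) A *
        (volume : Measure (E n)).real (Metric.ball 0 r) := by
  have hf : Module.finrank ℝ (E n) = n := finrank_euclideanSpace_fin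
  simp_rw [inner_apply_self_eq_sum hA hf]
  rw [integral_finsetSum]
  · rw [hA.trace_eq_sum_eigenvalues hf]
    simp only [RCLike.ofReal_real_eq_id, id]
    rw [Finset.mul_sum, Finset.sum_mul]
    refine Finset.sum_congr rfl fun i _ => ?_
    rw [integral_const_mul, setIntegral_ball_unit_inner_sq hn
      ((hA.eigenvectorBasis hf).norm_eq_one i) hr]
    ring
  · intro i _
    exact continuous_integrableOn_ball (by fun_prop) 0 r

theorem setAverage_ball_quadratic (hn : 1 ≤ n) {A : E n →L[ℝ] E n}
    (hA : (A : E n →ₗ[ℝ] E n).IsSymmetric) (x ξ : E n) (a : ℝ) {r : ℝ} (hr : 0 < r) :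
    ⨍ y in Metric.ball x r, (a + inner ℝ ξ (y - x) + 1 / 2 * inner ℝ (A (y - x)) (y - x) : ℝ) =
      a + r ^ 2 / (2 * (n + 2)) * LinearMap.trace ℝ (E n) A := by
  have hv := volume_real_ball_pos (0 : E n) hr
  have hv' : (volume : Measure (E n)).real (Metric.ball x r) =
      (volume : Measure (E n)).real (Metric.ball 0 r) := by
    rw [volume_real_ball hn x hr.le, volume_real_ball hn 0 hr.le]
  rw [setAverage_eq, setIntegral_ball_sub_center
    (fun h => (a + inner ℝ ξ h + 1 / 2 * inner ℝ (A h) h : ℝ)), hv', integral_add, integral_add,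
    integral_const_mul, setIntegral_ball_quadratic hn hA hr.le, setIntegral_ball_inner]
  · simp only [integral_const, MeasurableSet.univ, measureReal_restrict_apply, univ_inter,
      smul_eq_mul]
    field_simp
    ring
  all_goals exact continuous_integrableOn_ball (by fun_prop) 0 r

end Averages

/-- The undiscounted right-hand side of the dynamic programming principle. -/
def gameOp {n : ℕ} (p ε : ℝ) (v : E n → ℝ) (x : E n) : ℝ :=
  (p - 2) / (p + n) / 2 * (sSup (v '' Metric.ball x ε) + sInf (v '' Metric.ball x ε)) +
    (n + 2) / (p + n) * ⨍ y in Metric.ball x ε, v y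

/-! ### Monotonicity of the game operator and discrete comparison -/

section Comparison

variable {n : ℕ}

theorem weights_add {p : ℝ} (hp : 2 < p) :
    (p - 2) / (p + n) + (n + 2) / (p + n) = 1 := by
  have : p + n ≠ 0 := by positivity
  field_simp; ring

theorem alpha_nonneg {p : ℝ} (hp : 2 < p) : 0 ≤ (p - 2) / (p + n) :=
  div_nonneg (by linarith) (by positivity)

theorem beta_pos {p : ℝ} (hp : 2 < p) : 0 < ((n : ℝ) + 2) / (p + n) := by positivity

theorem bddAbove_image_of_abs_le {X : Type*} {u : X → ℝ} {s : Set X} {M : ℝ}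
    (h : ∀ y ∈ s, |u y| ≤ M) : BddAbove (u '' s) := by
  refine ⟨M, ?_⟩
  rintro _ ⟨y, hy, rfl⟩
  exact (le_abs_self _).trans (h y hy)

theorem bddBelow_image_of_abs_le {X : Type*} {u : X → ℝ} {s : Set X} {M : ℝ}
    (h : ∀ y ∈ s, |u y| ≤ M) : BddBelow (u '' s) := by
  refine ⟨-M, ?_⟩
  rintro _ ⟨y, hy, rfl⟩
  exact (abs_le.mp (h y hy)).1

theorem csSup_image_le_add {X : Type*} {u w : X → ℝ} {s : Set X} (hs : s.Nonempty) {m : ℝ}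
    (hw : BddAbove (w '' s)) (h : ∀ y ∈ s, u y ≤ w y + m) :
    sSup (u '' s) ≤ sSup (w '' s) + m := by
  refine csSup_le (hs.image u) ?_
  rintro _ ⟨y, hy, rfl⟩
  exact (h y hy).trans (by gcongr; exact le_csSup hw (mem_image_of_mem w hy))

theorem csInf_image_le_add {X : Type*} {u w : X → ℝ} {s : Set X} (hs : s.Nonempty) {m : ℝ}
    (hu : BddBelow (u '' s)) (h : ∀ y ∈ s, u y ≤ w y + m) :
    sInf (u '' s) ≤ sInf (w '' s) + m := by
  rw [← sub_le_iff_le_add]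
  refine le_csInf (hs.image w) ?_
  rintro _ ⟨y, hy, rfl⟩
  rw [sub_le_iff_le_add]
  exact (csInf_le hu (mem_image_of_mem u hy)).trans (h y hy)

theorem setAverage_eq_add_setAverage_sub {u w : E n → ℝ} {x : E n} {ε : ℝ}
    (hu : IntegrableOn u (Metric.ball x ε)) (hw : IntegrableOn w (Metric.ball x ε)) :
    ⨍ y in Metric.ball x ε, u y = (⨍ y in Metric.ball x ε, w y) +
      ⨍ y in Metric.ball x ε, (u y - w y) := by
  simp only [setAverage_eq, smul_eq_mul]
  rw [integral_sub hu hw]; ring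

/-- If `u ≤ w + m` on the ball and the average of `u - w` is at most `m - d`, then `gameOp`
satisfies the corresponding inequality. -/
theorem gameOp_le_add {p : ℝ} (hp : 2 < p) {ε : ℝ} (hε : 0 < ε) {u w : E n → ℝ} {x : E n}
    {M m d : ℝ} (hui : IntegrableOn u (Metric.ball x ε)) (hwi : IntegrableOn w (Metric.ball x ε))
    (hu : ∀ y ∈ Metric.ball x ε, |u y| ≤ M) (hw : ∀ y ∈ Metric.ball x ε, |w y| ≤ M)
    (h : ∀ y ∈ Metric.ball x ε, u y ≤ w y + m)
    (hd : ⨍ y in Metric.ball x ε, (u y - w y) ≤ m - d) :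
    gameOp p ε u x ≤ gameOp p ε w x + m - (n + 2) / (p + n) * d := by
  have hne : (Metric.ball x ε).Nonempty := ⟨x, Metric.mem_ball_self hε⟩
  have h1 := csSup_image_le_add hne (bddAbove_image_of_abs_le hw) h
  have h2 := csInf_image_le_add hne (bddBelow_image_of_abs_le hu) h
  have h3 := setAverage_eq_add_setAverage_sub hui hwi
  have hα := alpha_nonneg (n := n) hp
  have hβ := beta_pos (n := n) hp
  have hαβ := weights_add (n := n) hp
  unfold gameOp
  set α := (p - 2) / (p + n)
  set β := ((n : ℝ) + 2) / (p + n)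
  have h4 : α / 2 * (sSup (u '' Metric.ball x ε) + sInf (u '' Metric.ball x ε)) ≤
      α / 2 * (sSup (w '' Metric.ball x ε) + sInf (w '' Metric.ball x ε)) + α * m := by
    have := mul_le_mul_of_nonneg_left (add_le_add h1 h2) (by positivity : 0 ≤ α / 2)
    linarith
  have h5 : β * ⨍ y in Metric.ball x ε, u y ≤
      β * (⨍ y in Metric.ball x ε, w y) + β * (m - d) := by
    rw [h3, mul_add]; gcongr
  have h6 : α * m + β * m = m := by rw [← add_mul, hαβ, one_mul]
  linarith

theorem setAverage_le_of_le {f : E n → ℝ} {x : E n} {ε m : ℝ} (hε : 0 < ε)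
    (hf : IntegrableOn f (Metric.ball x ε)) (h : ∀ y ∈ Metric.ball x ε, f y ≤ m) :
    ⨍ y in Metric.ball x ε, f y ≤ m := by
  have hv := volume_real_ball_pos x hε
  rw [setAverage_eq, smul_eq_mul, inv_mul_le_iff₀ hv]
  calc ∫ y in Metric.ball x ε, f y ≤ ∫ y in Metric.ball x ε, m :=
        setIntegral_mono_on hf (continuous_integrableOn_ball continuous_const x ε)
          measurableSet_ball h
    _ = _ := by simp

theorem gameOp_mono_add {p : ℝ} (hp : 2 < p) {ε : ℝ} (hε : 0 < ε) {u w : E n → ℝ} {x : E n}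
    {M m : ℝ} (hui : IntegrableOn u (Metric.ball x ε)) (hwi : IntegrableOn w (Metric.ball x ε))
    (hu : ∀ y ∈ Metric.ball x ε, |u y| ≤ M) (hw : ∀ y ∈ Metric.ball x ε, |w y| ≤ M)
    (h : ∀ y ∈ Metric.ball x ε, u y ≤ w y + m) :
    gameOp p ε u x ≤ gameOp p ε w x + m := by
  have := gameOp_le_add (d := 0) hp hε hui hwi hu hw h (by
    rw [sub_zero]
    exact setAverage_le_of_le hε (hui.sub hwi) fun y hy => by
      have := h y hy; linarith)
  linarith

/-- The small ball occupies the fraction `(1/4)^n` of the large one, so a gain `d` on it survives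
averaging with this factor. -/
theorem setAverage_le_of_le_subball (hn : 1 ≤ n) {f : E n → ℝ} {x z : E n} {ε m d : ℝ}
    (hε : 0 < ε) (hf : IntegrableOn f (Metric.ball x ε))
    (h : ∀ y ∈ Metric.ball x ε, f y ≤ m) (hz : Metric.ball z (ε / 4) ⊆ Metric.ball x ε)
    (h' : ∀ y ∈ Metric.ball z (ε / 4), f y ≤ m - d) :
    ⨍ y in Metric.ball x ε, f y ≤ m - (1 / 4) ^ n * d := by
  have hv := volume_real_ball_pos x hε
  have hvz : (volume : Measure (E n)).real (Metric.ball z (ε / 4)) =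
      (1 / 4) ^ n * (volume : Measure (E n)).real (Metric.ball x ε) := by
    rw [volume_real_ball hn x hε.le, volume_real_ball hn z (by positivity), div_eq_mul_inv ε 4,
      mul_pow]
    ring
  have hi : IntegrableOn ((Metric.ball z (ε / 4)).indicator fun _ => d) (Metric.ball x ε) :=
    ((continuous_integrableOn_ball continuous_const z (ε / 4)).integrable_indicator
      measurableSet_ball).integrableOn
  have hc : IntegrableOn (fun _ => m) (Metric.ball x ε) :=
    continuous_integrableOn_ball continuous_const x ε
  rw [setAverage_eq, smul_eq_mul, inv_mul_le_iff₀ hv]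
  calc ∫ y in Metric.ball x ε, f y
      ≤ ∫ y in Metric.ball x ε, (m - (Metric.ball z (ε / 4)).indicator (fun _ => d) y) := by
        refine setIntegral_mono_on hf (hc.sub hi) measurableSet_ball fun y hy => ?_
        by_cases hyz : y ∈ Metric.ball z (ε / 4)
        · rw [indicator_of_mem hyz]; exact h' y hyz
        · rw [indicator_of_notMem hyz, sub_zero]; exact h y hy
    _ = _ := by
        rw [integral_sub hc hi, setIntegral_indicator measurableSet_ball,
          inter_eq_self_of_subset_right hz]
        simp only [setIntegral_const, smul_eq_mul, hvz]
        ring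

/-- Comparison principle for bounded sub- and supersolutions of the dynamic programming
principle in a bounded set. -/
theorem comparison (hn : 1 ≤ n) {p : ℝ} (hp : 2 < p) {ε q M : ℝ} (hε : 0 < ε) (hq : 0 ≤ q)
    (hq1 : q ≤ 1) {A : Set (E n)} (hA : Bornology.IsBounded A) {u w : E n → ℝ}
    (hui : ∀ x ∈ A, IntegrableOn u (Metric.ball x ε))
    (hwi : ∀ x ∈ A, IntegrableOn w (Metric.ball x ε))
    (hu : ∀ x ∈ A, ∀ y ∈ Metric.ball x ε, |u y| ≤ M)
    (hw : ∀ x ∈ A, ∀ y ∈ Metric.ball x ε, |w y| ≤ M)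
    (hsub : ∀ x ∈ A, u x ≤ q * gameOp p ε u x) (hsup : ∀ x ∈ A, q * gameOp p ε w x ≤ w x)
    (hbd : ∀ x ∈ A, ∀ y ∈ Metric.ball x ε, y ∉ A → u y ≤ w y) :
    ∀ x ∈ A, u x ≤ w x := by
  rcases A.eq_empty_or_nonempty with rfl | hAne
  · simp
  obtain ⟨R, hR⟩ := hA.subset_closedBall (0 : E n)
  set e : E n := EuclideanSpace.single ⟨0, hn⟩ 1
  have he : ‖e‖ = 1 := by simp [e]
  have hbdd : BddAbove ((fun x => u x - w x) '' A) := by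
    refine ⟨2 * M, ?_⟩
    rintro _ ⟨x, hx, rfl⟩
    have h1 := abs_le.mp (hu x hx x (Metric.mem_ball_self hε))
    have h2 := abs_le.mp (hw x hx x (Metric.mem_ball_self hε))
    simp only; linarith [h1.2, h2.1]
  by_contra! hcon
  obtain ⟨x₁, hx₁, hlt⟩ := hcon
  set m := sSup ((fun x => u x - w x) '' A) with hm
  have hmle : ∀ x ∈ A, u x - w x ≤ m := fun x hx => le_csSup hbdd ⟨x, hx, rfl⟩
  have hm0 : 0 < m := lt_of_lt_of_le (by linarith) (hmle x₁ hx₁)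
  -- Fraction of a gain on a ball of radius `ε/4` that one application of the game operator retains.
  set θ : ℝ := (n + 2) / (p + n) * (1 / 4) ^ n with hθ
  have hβ := beta_pos (n := n) hp
  have hθ0 : 0 < θ := by positivity
  have hθ1 : θ ≤ 1 := by
    have h1 : ((n : ℝ) + 2) / (p + n) ≤ 1 := by
      linarith [weights_add (n := n) hp, alpha_nonneg (n := n) hp]
    have h2 : ((1 : ℝ) / 4) ^ n ≤ 1 := pow_le_one₀ (by norm_num) (by norm_num)
    exact mul_le_one₀ h1 (by positivity) h2
  have hball : ∀ x ∈ A, ∀ y ∈ Metric.ball x ε, u y ≤ w y + m := by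
    intro x hx y hy
    by_cases hyA : y ∈ A
    · linarith [hmle y hyA]
    · linarith [hbd x hx y hy hyA]
  -- Sweep `A` by half-spaces orthogonal to `e`, starting beyond its extreme point, where the claim
  -- is vacuous. The ball of radius `ε/4` about `x + (ε/2)e` lies in `B_ε(x)` and at least `ε/4`
  -- further in direction `e`, so the gain known there passes to `x` with factor `θ`. No discount is
  -- needed, and the supremum need not be attained.
  have key : ∀ k : ℕ, ∀ x ∈ A, R + ε / 4 - k * (ε / 4) ≤ inner ℝ e x →
      u x - w x ≤ m - θ ^ k * m := by
    intro k
    induction k with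
    | zero =>
      intro x hx hex
      exfalso
      have h1 : (inner ℝ e x : ℝ) ≤ ‖x‖ := by
        simpa [he] using real_inner_le_norm e x
      have h2 : ‖x‖ ≤ R := by simpa using hR hx
      simp only [CharP.cast_eq_zero, zero_mul, sub_zero] at hex
      linarith
    | succ k ih =>
      intro x hx hex
      have hsubset : Metric.ball (x + (ε / 2) • e) (ε / 4) ⊆ Metric.ball x ε := by
        apply Metric.ball_subset_ball'
        rw [dist_eq_norm, add_sub_cancel_left, norm_smul, he, Real.norm_eq_abs,
          abs_of_pos (by positivity)]
        linarith
      have hd := setAverage_le_of_le_subball hn (f := fun y => u y - w y) (m := m)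
        (d := θ ^ k * m) hε ((hui x hx).sub (hwi x hx))
        (fun y hy => by linarith [hball x hx y hy]) hsubset (by
          intro y hy
          by_cases hyA : y ∈ A
          · refine ih y hyA ?_
            have h1 : (inner ℝ e y : ℝ) = inner ℝ e x + ε / 2 +
                inner ℝ e (y - (x + (ε / 2) • e)) := by
              rw [inner_sub_right, inner_add_right, inner_smul_right, real_inner_self_eq_norm_sq,
                he]
              ring
            have h2 : -(ε / 4) ≤ (inner ℝ e (y - (x + (ε / 2) • e)) : ℝ) := by
              have h3 := abs_real_inner_le_norm e (y - (x + (ε / 2) • e))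
              rw [he, one_mul] at h3
              have h4 : ‖y - (x + (ε / 2) • e)‖ < ε / 4 := by
                rwa [← dist_eq_norm]
              linarith [(abs_le.mp h3).1]
            push_cast at hex
            rw [h1]; linarith
          · have h1 := hbd x hx y (hsubset hy) hyA
            have h2 : θ ^ k * m ≤ m := mul_le_of_le_one_left hm0.le (pow_le_one₀ hθ0.le hθ1)
            linarith)
      have h1 := gameOp_le_add hp hε (hui x hx) (hwi x hx) (hu x hx) (hw x hx) (hball x hx) hd
      have h2 : u x - w x ≤ q * (m - (n + 2) / (p + n) * ((1 / 4) ^ n * (θ ^ k * m))) := by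
        have := mul_le_mul_of_nonneg_left h1 hq
        have h3 := hsub x hx
        have h4 := hsup x hx
        linarith
      have h3 : (n + 2) / (p + n) * ((1 / 4) ^ n * (θ ^ k * m)) = θ ^ (k + 1) * m := by
        rw [hθ]; ring
      rw [h3] at h2
      refine h2.trans (mul_le_of_le_one_left ?_ hq1)
      have h2 : θ ^ (k + 1) * m ≤ m := mul_le_of_le_one_left hm0.le (pow_le_one₀ hθ0.le hθ1)
      linarith
  -- After this many steps the half-space contains all of `A`, so the supremum `m` would lie
  -- strictly below itself.
  obtain ⟨k, hk⟩ := exists_nat_gt ((2 * R + ε / 4) / (ε / 4))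
  rw [div_lt_iff₀ (by positivity)] at hk
  have hfin : m ≤ m - θ ^ k * m := by
    refine csSup_le (hAne.image _) ?_
    rintro _ ⟨x, hx, rfl⟩
    refine key k x hx ?_
    have h1 : -‖x‖ ≤ (inner ℝ e x : ℝ) := by
      have := abs_real_inner_le_norm e x
      rw [he, one_mul] at this
      exact (abs_le.mp this).1
    have h2 : ‖x‖ ≤ R := by simpa using hR hx
    linarith
  have : 0 < θ ^ k * m := by positivity
  linarith

end Comparison

/-! ### Geometry of the domain and its boundary strip -/

section Domain

variable {n : ℕ} {Ω : Set (E n)}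

/-- The segment from `x` to `y` is connected, so it cannot be split between the interiors of `Ω` and
of its complement. -/
theorem exists_mem_frontier_dist_le {x y : E n} (hx : x ∈ Ω) (hy : y ∉ Ω) :
    ∃ z ∈ frontier Ω, dist x z ≤ dist x y ∧ dist y z ≤ dist x y := by
  have hc : IsPreconnected (segment ℝ x y) := (convex_segment x y).isPreconnected
  obtain ⟨z, hz, hzf⟩ : (segment ℝ x y ∩ frontier Ω).Nonempty := by
    by_contra hemp
    have hnf : ∀ z ∈ segment ℝ x y, z ∉ frontier Ω := fun z hz hzf => hemp ⟨z, hz, hzf⟩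
    have hcov : ∀ z ∈ segment ℝ x y, (z ∈ Ω → z ∈ interior Ω) ∧ (z ∉ Ω → z ∈ interior Ωᶜ) := by
      intro z hz
      refine ⟨fun h => ?_, fun h => ?_⟩
      · by_contra h'
        exact hnf z hz ⟨subset_closure h, h'⟩
      · by_contra h'
        rw [interior_compl, notMem_compl_iff] at h'
        exact hnf z hz ⟨h', fun h'' => h (interior_subset h'')⟩
    have hx' := left_mem_segment ℝ x y
    have hy' := right_mem_segment ℝ x y
    obtain ⟨z, -, hz1, hz2⟩ := hc _ _ isOpen_interior isOpen_interior
      (fun z hz => (em (z ∈ Ω)).imp (hcov z hz).1 (hcov z hz).2)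
      ⟨x, hx', (hcov x hx').1 hx⟩ ⟨y, hy', (hcov y hy').2 hy⟩
    exact interior_subset hz2 (interior_subset hz1)
  have h := dist_add_dist_of_mem_segment hz
  refine ⟨z, hzf, ?_, ?_⟩
  · linarith [dist_nonneg (x := z) (y := y)]
  · rw [dist_comm y z]; linarith [dist_nonneg (x := x) (y := z)]

theorem ball_subset_union_strip {x : E n} (hx : x ∈ Ω) (ε : ℝ) :
    Metric.ball x ε ⊆ Ω ∪ strip Ω ε := by
  intro y hy
  by_cases hyΩ : y ∈ Ω
  · exact Or.inl hyΩ
  · obtain ⟨z, hz, -, h⟩ := exists_mem_frontier_dist_le hx hyΩ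
    refine Or.inr ⟨hyΩ, (Metric.infDist_le_dist_of_mem hz).trans (h.trans ?_)⟩
    rw [dist_comm]; exact (Metric.mem_ball.mp hy).le

theorem strip_mono {ε ε' : ℝ} (h : ε ≤ ε') : strip Ω ε ⊆ strip Ω ε' :=
  fun _ hx => ⟨hx.1, hx.2.trans h⟩

theorem isClosed_strip (hΩ : IsOpen Ω) (ε : ℝ) : IsClosed (strip Ω ε) :=
  hΩ.isClosed_compl.inter
    (isClosed_le (Metric.continuous_infDist_pt (frontier Ω)) continuous_const)

theorem frontier_subset_strip (hΩ : IsOpen Ω) {ε : ℝ} (hε : 0 ≤ ε) :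
    frontier Ω ⊆ strip Ω ε := by
  intro x hx
  refine ⟨?_, by rwa [Metric.infDist_zero_of_mem hx]⟩
  rw [hΩ.frontier_eq] at hx
  exact hx.2

theorem closure_subset_union_strip (hΩ : IsOpen Ω) {ε : ℝ} (hε : 0 ≤ ε) :
    closure Ω ⊆ Ω ∪ strip Ω ε := by
  rw [closure_eq_self_union_frontier]
  exact union_subset_union_right _ (frontier_subset_strip hΩ hε)

theorem frontier_nonempty_of_isBounded (hn : 1 ≤ n) (hne : Ω.Nonempty)
    (hb : Bornology.IsBounded Ω) : (frontier Ω).Nonempty := by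
  have : Nonempty (Fin n) := ⟨⟨0, hn⟩⟩
  have : Nontrivial (E n) := inferInstance
  refine nonempty_frontier_iff.mpr ⟨hne, ?_⟩
  rintro rfl
  exact NormedSpace.unbounded_univ ℝ (E n) hb

theorem isCompact_frontier_of_isBounded (hb : Bornology.IsBounded Ω) :
    IsCompact (frontier Ω) :=
  hb.isCompact_closure.of_isClosed_subset isClosed_frontier frontier_subset_closure

theorem exists_frontier_dist_le_of_mem_strip (hfn : (frontier Ω).Nonempty)
    (hb : Bornology.IsBounded Ω) {ε : ℝ} {x : E n} (hx : x ∈ strip Ω ε) :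
    ∃ z ∈ frontier Ω, dist x z ≤ ε := by
  obtain ⟨z, hz, h⟩ := (isCompact_frontier_of_isBounded hb).exists_infDist_eq_dist hfn x
  exact ⟨z, hz, h ▸ hx.2⟩

theorem exists_bound_on_strip (hfn : (frontier Ω).Nonempty) (hb : Bornology.IsBounded Ω)
    {ε₀ L : ℝ} {F : E n → ℝ}
    (hL : ∀ x ∈ strip Ω ε₀, ∀ z ∈ strip Ω ε₀, |F x - F z| ≤ L * ‖x - z‖) :
    ∃ M : ℝ, 0 ≤ M ∧ ∀ x ∈ strip Ω ε₀, |F x| ≤ M := by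
  rcases (strip Ω ε₀).eq_empty_or_nonempty with h | ⟨x₀, hx₀⟩
  · exact ⟨0, le_rfl, by simp [h]⟩
  obtain ⟨R, hR⟩ := (isCompact_frontier_of_isBounded hb).isBounded.subset_closedBall x₀
  refine ⟨|F x₀| + |L| * (|ε₀| + |R|), by positivity, fun x hx => ?_⟩
  obtain ⟨z, hz, hxz⟩ := exists_frontier_dist_le_of_mem_strip hfn hb hx
  have h1 : dist z x₀ ≤ R := hR hz
  have h2 : ‖x - x₀‖ ≤ |ε₀| + |R| := by
    rw [← dist_eq_norm]
    linarith [dist_triangle x z x₀, le_abs_self ε₀, le_abs_self R]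
  have h3 : L * ‖x - x₀‖ ≤ |L| * (|ε₀| + |R|) := by
    gcongr; exact le_abs_self L
  have h4 := abs_sub_abs_le_abs_sub (F x) (F x₀)
  linarith [hL x hx x₀ hx₀]

end Domain

/-! ### First properties of solutions of the dynamic programming principle -/

section DPP

variable {n : ℕ} {Ω : Set (E n)} {p γ ε : ℝ} {F v : E n → ℝ}

theorem integrableOn_ball_of_measurable {w : E n → ℝ} (hw : Measurable w) {x : E n} {r M : ℝ}
    (h : ∀ y ∈ Metric.ball x r, |w y| ≤ M) : IntegrableOn w (Metric.ball x r) :=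
  Measure.integrableOn_of_bounded (M := M) measure_ball_lt_top.ne hw.aestronglyMeasurable
    ((ae_restrict_iff' measurableSet_ball).mpr (Eventually.of_forall h))

/-- Measurability is known only on `Ω ∪ Γ_ε`, which contains the ball; elsewhere `v` is arbitrary.
-/
theorem IsDPPSolution.integrableOn_ball (hΩ : IsOpen Ω) (h : IsDPPSolution Ω p γ ε F v)
    {x : E n} (hx : x ∈ Ω) : IntegrableOn v (Metric.ball x ε) := by
  obtain ⟨M, hM⟩ := h.bounded
  have hsub := ball_subset_union_strip hx ε
  have hms : MeasurableSet (Ω ∪ strip Ω ε) :=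
    hΩ.measurableSet.union (isClosed_strip hΩ ε).measurableSet
  have hm : AEMeasurable v (volume.restrict (Ω ∪ strip Ω ε)) := by
    rw [aemeasurable_restrict_iff_comap_subtype hms]
    exact h.measurable.aemeasurable
  exact IntegrableOn.of_bound measure_ball_lt_top (hm.mono_set hsub).aestronglyMeasurable M
    ((ae_restrict_iff' measurableSet_ball).mpr (Eventually.of_forall fun y hy => hM y (hsub hy)))

theorem gameOp_neg (v : E n → ℝ) (x : E n) :
    gameOp p ε (fun y => -v y) x = -gameOp p ε v x := by
  unfold gameOp
  have h1 : (fun y => -v y) '' Metric.ball x ε = -(v '' Metric.ball x ε) := by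
    rw [← image_neg_eq_neg, image_image]
  rw [h1, Real.sSup_neg, Real.sInf_neg, setAverage_eq, setAverage_eq, integral_neg]
  simp only [smul_eq_mul]
  ring

theorem gameOp_const (hp : 2 < p) (hε : 0 < ε) (c : ℝ) (x : E n) :
    gameOp p ε (fun _ => c) x = c := by
  have hne : (Metric.ball x ε).Nonempty := ⟨x, Metric.mem_ball_self hε⟩
  have hv := volume_real_ball_pos x hε
  have h1 := weights_add (n := n) hp
  unfold gameOp
  rw [hne.image_const, csSup_singleton, csInf_singleton, setAverage_eq, setIntegral_const,
    smul_eq_mul, smul_eq_mul, inv_mul_cancel_left₀ hv.ne']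
  linear_combination c * h1

/-- This symmetry turns every upper estimate into a lower one. -/
theorem IsDPPSolution.neg (h : IsDPPSolution Ω p γ ε F v) :
    IsDPPSolution Ω p γ ε (fun x => -F x) (fun x => -v x) where
  measurable := h.measurable.neg
  bounded := by simpa using h.bounded
  boundary x hx := by rw [h.boundary x hx]
  dpp x hx := by
    have := gameOp_neg (p := p) (ε := ε) v x
    unfold gameOp at this
    rw [this, h.dpp x hx]; ring

theorem IsDPPSolution.eq_gameOp (h : IsDPPSolution Ω p γ ε F v) {x : E n} (hx : x ∈ Ω) :
    v x = (1 - γ * ε ^ 2) * gameOp p ε v x :=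
  h.dpp x hx

/-- The constant `M` is a supersolution because the discount can only lower a nonnegative number. -/
theorem IsDPPSolution.le_of_boundary_le (hn : 1 ≤ n) (hp : 2 < p) (hγ : 0 ≤ γ) (hε : 0 < ε)
    (hγε : γ * ε ^ 2 < 1 / 2) (hΩ : IsOpen Ω) (hb : Bornology.IsBounded Ω)
    (h : IsDPPSolution Ω p γ ε F v) {M : ℝ} (hM0 : 0 ≤ M) (hM : ∀ x ∈ strip Ω ε, F x ≤ M)
    {x : E n} (hx : x ∈ Ω ∪ strip Ω ε) : v x ≤ M := by
  rcases hx with hx | hx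
  swap
  · rw [h.boundary x hx]; exact hM x hx
  obtain ⟨M', hM'⟩ := h.bounded
  have hγε0 : 0 ≤ γ * ε ^ 2 := by positivity
  refine comparison hn hp (q := 1 - γ * ε ^ 2) (M := max M' M) hε (by linarith) (by linarith) hb
    (u := v) (w := fun _ => M) (fun x hx => h.integrableOn_ball hΩ hx)
    (fun x _ => continuous_integrableOn_ball continuous_const x ε)
    (fun x hx y hy => (hM' y (ball_subset_union_strip hx ε hy)).trans (le_max_left _ _))
    (fun x _ y _ => by rw [abs_of_nonneg hM0]; exact le_max_right _ _)
    (fun x hx => (h.eq_gameOp hx).le) (fun x _ => ?_) (fun x hx y hy hyΩ => ?_) x hx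
  · rw [gameOp_const hp hε]
    exact mul_le_of_le_one_left hM0 (by linarith)
  · have hy' := (ball_subset_union_strip hx ε hy).resolve_left hyΩ
    rw [h.boundary y hy']; exact hM y hy'

theorem IsDPPSolution.abs_le_of_boundary (hn : 1 ≤ n) (hp : 2 < p) (hγ : 0 ≤ γ) (hε : 0 < ε)
    (hγε : γ * ε ^ 2 < 1 / 2) (hΩ : IsOpen Ω) (hb : Bornology.IsBounded Ω)
    (h : IsDPPSolution Ω p γ ε F v) {M : ℝ} (hM0 : 0 ≤ M) (hM : ∀ x ∈ strip Ω ε, |F x| ≤ M)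
    {x : E n} (hx : x ∈ Ω ∪ strip Ω ε) : |v x| ≤ M := by
  refine abs_le'.mpr ⟨?_, ?_⟩
  · exact h.le_of_boundary_le hn hp hγ hε hγε hΩ hb hM0
      (fun x hx => (le_abs_self _).trans (hM x hx)) hx
  · exact h.neg.le_of_boundary_le hn hp hγ hε hγε hΩ hb hM0
      (fun x hx => (neg_le_abs _).trans (hM x hx)) hx

theorem csSup_image_ball_le {w : E n → ℝ} {x : E n} (hε : 0 < ε) {K : ℝ}
    (h : ∀ y ∈ Metric.ball x ε, w y ≤ K) : sSup (w '' Metric.ball x ε) ≤ K := by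
  refine csSup_le (Nonempty.image w ⟨x, Metric.mem_ball_self hε⟩) ?_
  rintro _ ⟨y, hy, rfl⟩
  exact h y hy

/-- Continuity admits points at distance exactly `ε`, although the infimum runs over the open ball.
-/
theorem csInf_image_ball_le {w : E n → ℝ} {x y : E n} (hε : 0 < ε)
    (hw : ContinuousOn w (Metric.closedBall x ε)) (hy : y ∈ Metric.closedBall x ε) :
    sInf (w '' Metric.ball x ε) ≤ w y := by
  have hbdd : BddBelow (w '' Metric.ball x ε) :=
    ((isCompact_closedBall x ε).bddBelow_image hw).mono (image_mono Metric.ball_subset_closedBall)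
  have hcl := closure_ball x hε.ne'
  refine le_on_closure (s := Metric.ball x ε) (f := fun _ => sInf (w '' Metric.ball x ε))
    (fun z hz => csInf_le hbdd (mem_image_of_mem w hz)) continuousOn_const (by rwa [hcl])
    (by rwa [hcl])

end DPP

/-! ### The radial barrier -/

section Barrier

/-- Convexity of `t ↦ t^(-k)`, obtained from Bernoulli's inequality for `s/t`. -/
theorem inv_pow_tangent_le {s t : ℝ} (hs : 0 < s) (ht : 0 < t) (k : ℕ) :
    s⁻¹ ^ k - k * s⁻¹ ^ (k + 1) * (t - s) ≤ t⁻¹ ^ k := by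
  have h1 : 1 + (k : ℝ) * (s / t - 1) ≤ (1 + (s / t - 1)) ^ k :=
    one_add_mul_le_pow (by have : 0 < s / t := by positivity
                           linarith) k
  have h2 : 1 - t / s ≤ s / t - 1 := by
    rw [← sub_nonneg]
    have : s / t - 1 - (1 - t / s) = (s - t) ^ 2 / (s * t) := by field_simp
    rw [this]; positivity
  have h3 : 1 + (k : ℝ) * (1 - t / s) ≤ (s / t) ^ k := by
    have := mul_le_mul_of_nonneg_left h2 (Nat.cast_nonneg (α := ℝ) k)
    rw [add_sub_cancel] at h1
    linarith
  have h4 := mul_le_mul_of_nonneg_left h3 (by positivity : 0 ≤ s⁻¹ ^ k)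
  have h5 : s⁻¹ ^ k * (s / t) ^ k = t⁻¹ ^ k := by
    rw [← mul_pow]; congr 1; field_simp
  have h6 : s⁻¹ ^ k * (1 + (k : ℝ) * (1 - t / s)) =
      s⁻¹ ^ k - k * s⁻¹ ^ (k + 1) * (t - s) := by
    rw [pow_succ]; field_simp; ring
  rw [← h5, ← h6]; exact h4

/-- Sum and difference are bounded together because the factors `(1 ± t)/(1 - t²)` of the induction
step mix them. -/
theorem two_add_le_inv_pow_add_inv_pow {t : ℝ} (ht0 : 0 ≤ t) (ht1 : t < 1) (m : ℕ) :
    2 + m * (m + 1) * t ^ 2 ≤ (1 - t)⁻¹ ^ m + (1 + t)⁻¹ ^ m ∧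
      2 * m * t ≤ (1 - t)⁻¹ ^ m - (1 + t)⁻¹ ^ m := by
  induction m with
  | zero => norm_num
  | succ m ih =>
    obtain ⟨h1, h2⟩ := ih
    have hd : 0 < 1 - t ^ 2 := by nlinarith
    have hd' : 1 - t ^ 2 ≤ 1 := by nlinarith
    have hm : (1 - t)⁻¹ = (1 + t) / (1 - t ^ 2) := by
      have : 1 - t ≠ 0 := by linarith
      field_simp; ring
    have hp : (1 + t)⁻¹ = (1 - t) / (1 - t ^ 2) := by
      have : 1 + t ≠ 0 := by linarith
      field_simp; ring
    rw [pow_succ (1 - t)⁻¹, pow_succ (1 + t)⁻¹]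
    set x := (1 - t)⁻¹ ^ m
    set y := (1 + t)⁻¹ ^ m
    rw [hm, hp]
    have hm0 : (0 : ℝ) ≤ m := Nat.cast_nonneg m
    constructor
    · have h3 : x * ((1 + t) / (1 - t ^ 2)) + y * ((1 - t) / (1 - t ^ 2)) =
        ((x + y) + t * (x - y)) / (1 - t ^ 2) := by field_simp; ring
      have h4 : 2 + (m : ℝ) * (m + 1) * t ^ 2 + t * (2 * m * t) ≤ (x + y) + t * (x - y) := by
        have := mul_le_mul_of_nonneg_left h2 ht0
        linarith
      rw [h3, le_div_iff₀ hd]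
      refine le_trans ?_ h4
      push_cast
      have h5 : 0 ≤ ((m : ℝ) + 1) * (m + 1 + 1) * t ^ 2 * t ^ 2 := by positivity
      nlinarith
    · have h3 : x * ((1 + t) / (1 - t ^ 2)) - y * ((1 - t) / (1 - t ^ 2)) =
        ((x - y) + t * (x + y)) / (1 - t ^ 2) := by field_simp; ring
      have h4 : 2 * m * t + t * 2 ≤ (x - y) + t * (x + y) := by
        have h5 : 2 ≤ x + y := by
          have : 0 ≤ (m : ℝ) * (m + 1) * t ^ 2 := by positivity
          linarith
        have := mul_le_mul_of_nonneg_left h5 ht0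
        linarith
      rw [h3, le_div_iff₀ hd]
      refine le_trans ?_ h4
      push_cast
      have : 0 ≤ 2 * ((m : ℝ) + 1) * t := by positivity
      nlinarith

theorem second_difference_inv_pow {r ε : ℝ} (hε : 0 ≤ ε) (hr : ε < r) (m : ℕ) :
    2 * r⁻¹ ^ m + m * (m + 1) * ε ^ 2 * r⁻¹ ^ (m + 2) ≤
      (r - ε)⁻¹ ^ m + (r + ε)⁻¹ ^ m := by
  have hr0 : 0 < r := by linarith
  have h := (two_add_le_inv_pow_add_inv_pow (t := ε / r) (by positivity)
    ((div_lt_one hr0).mpr hr) m).1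
  have h1 : (r - ε)⁻¹ ^ m = r⁻¹ ^ m * (1 - ε / r)⁻¹ ^ m := by
    rw [← mul_pow, ← mul_inv]; congr 2; field_simp
  have h2 : (r + ε)⁻¹ ^ m = r⁻¹ ^ m * (1 + ε / r)⁻¹ ^ m := by
    rw [← mul_pow, ← mul_inv]; congr 2; field_simp
  rw [h1, h2, ← mul_add]
  refine le_trans (le_of_eq ?_) (mul_le_mul_of_nonneg_left h (by positivity))
  rw [pow_add]; field_simp

variable {n : ℕ}

/-- The radial barrier `a - C |y - z|^{-2k}`. -/
def barrier (a C : ℝ) (k : ℕ) (z y : E n) : ℝ := a - C * (‖y - z‖ ^ 2)⁻¹ ^ k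

theorem measurable_barrier (a C : ℝ) (k : ℕ) (z : E n) : Measurable (barrier a C k z) := by
  unfold barrier; fun_prop

theorem abs_barrier_le {a C b : ℝ} (hb : 0 < b) (k : ℕ) {z y : E n} (hy : b ≤ ‖y - z‖ ^ 2) :
    |barrier a C k z y| ≤ |a| + |C| * b⁻¹ ^ k := by
  unfold barrier
  refine (abs_sub _ _).trans ?_
  rw [abs_mul, abs_of_nonneg (by positivity : 0 ≤ (‖y - z‖ ^ 2)⁻¹ ^ k)]
  gcongr

theorem continuousOn_barrier (a C : ℝ) (k : ℕ) (z : E n) {s : Set (E n)} (hs : z ∉ s) :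
    ContinuousOn (barrier a C k z) s := by
  unfold barrier
  refine continuousOn_const.sub (continuousOn_const.mul (ContinuousOn.pow ?_ k))
  refine ContinuousOn.inv₀ (by fun_prop) fun y hy => ?_
  have : y - z ≠ 0 := sub_ne_zero.mpr fun h => hs (h ▸ hy)
  positivity

theorem trace_id_smul (c : ℝ) :
    LinearMap.trace ℝ (E n) ((c • ContinuousLinearMap.id ℝ (E n) : E n →L[ℝ] E n)) = c * n := by
  have h : ((c • ContinuousLinearMap.id ℝ (E n) : E n →L[ℝ] E n) : E n →ₗ[ℝ] E n) =
      c • LinearMap.id := rfl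
  rw [h, map_smul, LinearMap.trace_id, finrank_euclideanSpace_fin, smul_eq_mul]

/-- By convexity in `|y - z|²`, the barrier lies below its tangent in that variable, which is a
quadratic polynomial in `y` with explicit mean. -/
theorem setAverage_barrier_le (hn : 1 ≤ n) {a C : ℝ} (hC : 0 ≤ C) (k : ℕ) {z x : E n} {ε : ℝ}
    (hε : 0 < ε) (hr : ε < ‖x - z‖) :
    ⨍ y in Metric.ball x ε, barrier a C k z y ≤
      barrier a C k z x + C * k * (‖x - z‖ ^ 2)⁻¹ ^ (k + 1) * (ε ^ 2 * n / (n + 2)) := by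
  set s := ‖x - z‖ ^ 2 with hs
  set D := C * k * s⁻¹ ^ (k + 1) with hD
  have hr0 : 0 < ‖x - z‖ := by linarith
  have hs0 : 0 < s := by positivity
  set A : E n →L[ℝ] E n := (2 * D) • ContinuousLinearMap.id ℝ (E n) with hA
  have hAs : (A : E n →ₗ[ℝ] E n).IsSymmetric := by
    intro u w
    simp [hA, inner_smul_left, inner_smul_right]
  have hq := setAverage_ball_quadratic hn hAs x ((2 * D) • (x - z)) (barrier a C k z x) hε
  rw [hA, trace_id_smul] at hq
  have hnear : ∀ y ∈ Metric.ball x ε, ‖x - z‖ - ε < ‖y - z‖ := by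
    intro y hy
    have h1 : ‖x - z‖ ≤ ‖x - y‖ + ‖y - z‖ := by
      simpa using norm_add_le (x - y) (y - z)
    have h2 : ‖x - y‖ < ε := by rw [← dist_eq_norm]; exact Metric.mem_ball'.mp hy
    linarith
  have hint : IntegrableOn (barrier a C k z) (Metric.ball x ε) := by
    have h0 : 0 < ‖x - z‖ - ε := by linarith
    refine integrableOn_ball_of_measurable (measurable_barrier a C k z)
      (M := |a| + |C| * ((‖x - z‖ - ε) ^ 2)⁻¹ ^ k) fun y hy => ?_
    refine abs_barrier_le (by positivity) k ?_
    have := hnear y hy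
    gcongr
  have hle : ⨍ y in Metric.ball x ε, barrier a C k z y ≤ ⨍ y in Metric.ball x ε,
      (barrier a C k z x + inner ℝ ((2 * D) • (x - z)) (y - x) +
        1 / 2 * inner ℝ (A (y - x)) (y - x) : ℝ) := by
    rw [setAverage_eq, setAverage_eq]
    refine smul_le_smul_of_nonneg_left ?_ (by positivity)
    refine setIntegral_mono_on hint (continuous_integrableOn_ball (by fun_prop) x ε)
      measurableSet_ball fun y hy => ?_
    have hy0 : 0 < ‖y - z‖ := by linarith [hnear y hy]
    have h1 := inv_pow_tangent_le hs0 (by positivity : 0 < ‖y - z‖ ^ 2) k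
    have h2 : ‖y - z‖ ^ 2 = s + 2 * inner ℝ (x - z) (y - x) + ‖y - x‖ ^ 2 := by
      rw [hs, ← norm_add_sq_real]; congr 2; abel
    have h3 := mul_le_mul_of_nonneg_left h1 hC
    simp only [hA, smul_apply, ContinuousLinearMap.id_apply,
      real_inner_smul_left, real_inner_self_eq_norm_sq]
    unfold barrier
    have h4 : C * (s⁻¹ ^ k - k * s⁻¹ ^ (k + 1) * (‖y - z‖ ^ 2 - s)) =
        C * s⁻¹ ^ k - D * (2 * inner ℝ (x - z) (y - x) + ‖y - x‖ ^ 2) := by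
      rw [h2, hD]; ring
    rw [h4] at h3
    rw [← hs]
    linarith
  refine hle.trans (hq.trans_le (le_of_eq ?_))
  have : (n : ℝ) + 2 ≠ 0 := by positivity
  field_simp

/-- The barrier increases with the radius, so supremum and infimum are controlled by the radii `r +
ε` and `r - ε`, and their second difference gains `2k(2k+1)`. The mean loses only a term linear in
`k`, so a large `k` wins; the condition on `k` makes the net factor at least `1`. Only `ε < r` is
required, with no error term. -/
theorem gameOp_barrier_le (hn : 1 ≤ n) {p : ℝ} (hp : 2 < p) {a C : ℝ} (hC : 0 ≤ C) {k : ℕ}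
    (hk1 : 1 ≤ k) (hk : p + 2 * n ≤ (p - 2) * (2 * k + 1)) {z x : E n} {ε : ℝ} (hε : 0 < ε)
    (hr : ε < ‖x - z‖) :
    gameOp p ε (barrier a C k z) x ≤
      barrier a C k z x - C * ε ^ 2 * (‖x - z‖ ^ 2)⁻¹ ^ (k + 1) := by
  have havg := setAverage_barrier_le hn (a := a) hC k hε hr
  set r := ‖x - z‖ with hrdef
  have hr0 : 0 < r := by linarith
  have hpow : ∀ (t : ℝ) (j : ℕ), (t ^ 2)⁻¹ ^ j = t⁻¹ ^ (2 * j) := by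
    intro t j; rw [← inv_pow, ← pow_mul]
  have hsup : sSup (barrier a C k z '' Metric.ball x ε) ≤ a - C * ((r + ε) ^ 2)⁻¹ ^ k := by
    refine csSup_image_ball_le hε fun y hy => ?_
    have h2 : ‖x - y‖ < ε := by rw [← dist_eq_norm]; exact Metric.mem_ball'.mp hy
    have h1 : r ≤ ‖x - y‖ + ‖y - z‖ := by
      simpa using norm_add_le (x - y) (y - z)
    have h3 : ‖y - z‖ ≤ ‖y - x‖ + r := by
      simpa using norm_add_le (y - x) (x - z)
    rw [norm_sub_rev y x] at h3
    have h4 : 0 < ‖y - z‖ := by linarith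
    have h5 : ‖y - z‖ ≤ r + ε := by linarith
    unfold barrier
    gcongr
  have hinf : sInf (barrier a C k z '' Metric.ball x ε) ≤ a - C * ((r - ε) ^ 2)⁻¹ ^ k := by
    have hc : ContinuousOn (barrier a C k z) (Metric.closedBall x ε) := by
      refine continuousOn_barrier a C k z fun h => ?_
      rw [Metric.mem_closedBall', dist_eq_norm] at h
      linarith
    have hmem : x - (ε / r) • (x - z) ∈ Metric.closedBall x ε := by
      rw [Metric.mem_closedBall', dist_eq_norm, sub_sub_cancel, norm_smul, Real.norm_eq_abs,
        abs_of_pos (by positivity), ← hrdef, div_mul_cancel₀ _ hr0.ne']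
    refine (csInf_image_ball_le hε hc hmem).trans (le_of_eq ?_)
    unfold barrier
    have h1 : x - (ε / r) • (x - z) - z = (1 - ε / r) • (x - z) := by
      rw [sub_smul, one_smul]; abel
    rw [h1, norm_smul, Real.norm_eq_abs, abs_of_pos (by
      rw [sub_pos, div_lt_one hr0]; exact hr), ← hrdef]
    congr 4; field_simp
  have hsd := second_difference_inv_pow hε.le hr (2 * k)
  have hsum : sSup (barrier a C k z '' Metric.ball x ε) +
      sInf (barrier a C k z '' Metric.ball x ε) ≤
      2 * barrier a C k z x - C * (2 * k * (2 * k + 1)) * ε ^ 2 * (r ^ 2)⁻¹ ^ (k + 1) := by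
    have h1 := mul_le_mul_of_nonneg_left hsd hC
    unfold barrier at hsup hinf ⊢
    rw [← hrdef]
    rw [hpow] at hsup hinf ⊢
    rw [hpow, show 2 * (k + 1) = 2 * k + 2 by ring]
    push_cast at h1
    linarith
  have hα := alpha_nonneg (n := n) hp
  have hβ := beta_pos (n := n) hp
  have hαβ := weights_add (n := n) hp
  have hpn : 0 < p + n := by positivity
  have hn2 : (n : ℝ) + 2 ≠ 0 := by positivity
  unfold gameOp
  have h1 := mul_le_mul_of_nonneg_left hsum
    (by positivity : 0 ≤ (p - 2) / (p + n) / 2)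
  have h2 := mul_le_mul_of_nonneg_left havg hβ.le
  set Y := (r ^ 2)⁻¹ ^ (k + 1)
  have hY : 0 ≤ Y := by positivity
  set w := barrier a C k z x
  have h3 : (p - 2) / (p + n) / 2 * (2 * w - C * (2 * k * (2 * k + 1)) * ε ^ 2 * Y) +
      (n + 2) / (p + n) * (w + C * k * Y * (ε ^ 2 * n / (n + 2))) =
      w - C * ε ^ 2 * Y * (k * (((p - 2) * (2 * k + 1) - n) / (p + n))) := by
    field_simp; ring
  refine (add_le_add h1 h2).trans (h3.trans_le ?_)
  have hk1' : (1 : ℝ) ≤ k := by exact_mod_cast hk1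
  have h4 : 1 ≤ ((p - 2) * (2 * k + 1) - n) / (p + n) := by
    rw [le_div_iff₀ hpn]; linarith
  have h5 : 1 ≤ k * (((p - 2) * (2 * k + 1) - n) / (p + n)) :=
    one_le_mul_of_one_le_of_one_le hk1' h4
  have h6 := mul_le_mul_of_nonneg_left h5 (by positivity : 0 ≤ C * ε ^ 2 * Y)
  linarith

end Barrier

/-! ### Boundary estimates uniform in the step size -/

section Boundary

variable {n : ℕ} {Ω : Set (E n)} {p γ : ℝ}

theorem norm_sub_midpoint_sq (x y z : E n) :
    ‖x - midpoint ℝ y z‖ ^ 2 = ‖x - z‖ ^ 2 / 2 + ‖x - y‖ ^ 2 / 2 - ‖y - z‖ ^ 2 / 4 := by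
  have h1 : x - midpoint ℝ y z = (1 / 2 : ℝ) • ((x - z) + (x - y)) := by
    rw [midpoint_eq_smul_add, invOf_eq_inv]
    module
  have h2 : y - z = (x - z) - (x - y) := by abel
  rw [h1, h2, norm_smul, mul_pow, norm_add_sq_real (x - z) (x - y),
    norm_sub_sq_real (x - z) (x - y)]
  norm_num
  ring

theorem exists_barrier_exponent (hp : 2 < p) :
    ∃ k : ℕ, 1 ≤ k ∧ p + 2 * n ≤ (p - 2) * (2 * k + 1) := by
  obtain ⟨k, hk⟩ := exists_nat_gt ((p + 2 * n) / (p - 2))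
  have hp2 : 0 < p - 2 := by linarith
  rw [div_lt_iff₀ hp2] at hk
  refine ⟨k + 1, by omega, ?_⟩
  push_cast
  have : 0 ≤ (k : ℝ) * (p - 2) := by positivity
  nlinarith

/-- Points of the strip may enter the exterior ball to depth `ε`, which lowers the squared radius
`s` to `s - δ ε`; for small `ε` the barrier's constants barely change. -/
theorem eventually_barrier_increment {s t c η C : ℝ} {k : ℕ} (hs : 0 < s) (ht : 0 < t) (hη : 0 < η)
    (hc : c = s⁻¹ ^ k - (s + t)⁻¹ ^ k) (hc0 : 0 < c) (δ : ℝ) :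
    ∀ᶠ ε in 𝓝 (0 : ℝ), s / 2 < s - δ * ε ∧
      c / 2 < (s - δ * ε)⁻¹ ^ k - (s - δ * ε + t)⁻¹ ^ k ∧
      C * (s - δ * ε)⁻¹ ^ k < C * s⁻¹ ^ k + η := by
  have h1 : Tendsto (fun ε : ℝ => s - δ * ε) (𝓝 0) (𝓝 s) := by
    have : ContinuousAt (fun ε : ℝ => s - δ * ε) 0 := by fun_prop
    simpa [ContinuousAt] using this
  have h2 : Tendsto (fun ε : ℝ => (s - δ * ε)⁻¹ ^ k) (𝓝 0) (𝓝 (s⁻¹ ^ k)) :=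
    (h1.inv₀ hs.ne').pow k
  have h3 : Tendsto (fun ε : ℝ => (s - δ * ε + t)⁻¹ ^ k) (𝓝 0) (𝓝 ((s + t)⁻¹ ^ k)) :=
    ((h1.add_const t).inv₀ (by positivity)).pow k
  refine (h1.eventually_const_lt (by linarith)).and
    (((h2.sub h3).eventually_const_lt ?_).and ((h2.const_mul C).eventually_lt_const ?_))
  · rw [← hc]; linarith
  · linarith

set_option maxHeartbeats 1000000 in
theorem boundary_upper (hn : 1 ≤ n) (hp : 2 < p) (hγ : 0 ≤ γ) (hΩo : IsOpen Ω)
    (hΩb : Bornology.IsBounded Ω) (hΩs : ExteriorSphere Ω) {ε₀ L : ℝ} (hε₀ : 0 < ε₀)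
    {F : E n → ℝ}
    (hL : ∀ x ∈ strip Ω ε₀, ∀ z ∈ strip Ω ε₀, |F x - F z| ≤ L * ‖x - z‖)
    {y₀ : E n} (hy₀ : y₀ ∈ frontier Ω) {η : ℝ} (hη : 0 < η) :
    ∃ ρ > 0, ∃ ε₁ > 0, ∀ ε v, 0 < ε → ε < ε₁ → ε ≤ ε₀ → γ * ε ^ 2 < 1 / 2 →
      IsDPPSolution Ω p γ ε F v → ∀ x ∈ Ω ∪ strip Ω ε, dist x y₀ < ρ → v x ≤ F y₀ + η := by
  have hfn : (frontier Ω).Nonempty := ⟨y₀, hy₀⟩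
  obtain ⟨M, hM0, hM⟩ := exists_bound_on_strip hfn hΩb hL
  obtain ⟨z₀, δ, hδ, hball, hsph⟩ := hΩs y₀ hy₀
  obtain ⟨k, hk1, hk⟩ := exists_barrier_exponent (n := n) hp
  -- The ball about this midpoint with radius `δ/2` meets the closure of `Ω` only at `y₀`: the
  -- squared distance to `z` is at least `δ²/4 + |x - y₀|²/2` there.
  set z := midpoint ℝ y₀ z₀ with hz
  obtain ⟨R, hR⟩ := hΩb.subset_closedBall z
  have hy₀z₀ : ‖y₀ - z₀‖ = δ := by rw [← dist_eq_norm]; exact hsph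
  have hzball : ∀ x ∈ closure Ω, δ ≤ ‖x - z₀‖ := by
    intro x hx
    have h1 : closure Ω ⊆ (Metric.ball z₀ δ)ᶜ :=
      closure_minimal (subset_compl_comm.mp hball) Metric.isOpen_ball.isClosed_compl
    have h2 := h1 hx
    rw [mem_compl_iff, Metric.mem_ball, not_lt, dist_eq_norm] at h2
    exact h2
  set s := δ ^ 2 / 4 with hs
  have hs0 : 0 < s := by positivity
  set ρ₀ := η / (4 * (|L| + 1)) with hρ₀
  have hρ₀0 : 0 < ρ₀ := by positivity
  set t := ρ₀ ^ 2 / 2 with ht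
  have ht0 : 0 < t := by positivity
  set c := s⁻¹ ^ k - (s + t)⁻¹ ^ k with hc
  have hc0 : 0 < c := by
    rw [hc, sub_pos]
    have : (s + t)⁻¹ < s⁻¹ := inv_strictAnti₀ hs0 (by linarith)
    exact pow_lt_pow_left₀ this (by positivity) (by omega)
  set a := F y₀ + η / 4 with ha
  have hFy : |F y₀| ≤ M := hM y₀ (frontier_subset_strip hΩo hε₀.le hy₀)
  -- The first term lifts the barrier above `M` on the strip away from `y₀`; the second absorbs the
  -- discount where the barrier is negative.
  set C := 4 * M / c + 2 * γ * M * (R ^ 2) ^ (k + 1) with hC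
  have hC0 : 0 ≤ C := by positivity
  have hev := (eventually_barrier_increment (C := C) (k := k) hs0 ht0 (by positivity : 0 < η / 4)
    hc hc0 δ).and (Iio_mem_nhds (by positivity : (0 : ℝ) < δ / 2))
  obtain ⟨ε₁, hε₁, hε₁'⟩ := Metric.eventually_nhds_iff.mp hev
  have hys : ‖y₀ - z‖ ^ 2 = s := by
    rw [hz, norm_sub_midpoint_sq, hy₀z₀, sub_self, norm_zero, hs]; ring
  have hcont : ∀ᶠ x in 𝓝 y₀, C * s⁻¹ ^ k - η / 4 < C * (‖x - z‖ ^ 2)⁻¹ ^ k := by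
    have h1 : ContinuousAt (fun x : E n => C * (‖x - z‖ ^ 2)⁻¹ ^ k) y₀ := by
      refine continuousAt_const.mul (ContinuousAt.pow (ContinuousAt.inv₀ (by fun_prop) ?_) k)
      rw [hys]; exact hs0.ne'
    refine h1.eventually_const_lt ?_
    simp only [hys]; linarith
  obtain ⟨ρ, hρ, hρ'⟩ := Metric.eventually_nhds_iff.mp hcont
  refine ⟨ρ, hρ, ε₁, hε₁, fun ε v hε hεε₁ hεε₀ hγε hv => ?_⟩
  have hgeo : ∀ x ∈ Ω ∪ strip Ω ε, s - δ * ε + ‖x - y₀‖ ^ 2 / 2 ≤ ‖x - z‖ ^ 2 := by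
    have hεδ : ε < δ / 2 := (hε₁' (y := ε) (by
      rw [Real.dist_eq, sub_zero, abs_of_pos hε]; exact hεε₁)).2
    intro x hx
    have h1 : δ - ε ≤ ‖x - z₀‖ := by
      rcases hx with hx | hx
      · linarith [hzball x (subset_closure hx)]
      · obtain ⟨x', hx', hd⟩ := exists_frontier_dist_le_of_mem_strip hfn hΩb hx
        have h2 := hzball x' (frontier_subset_closure hx')
        have h3 := dist_triangle x' x z₀
        rw [dist_comm x' x, dist_eq_norm x' z₀, dist_eq_norm x z₀] at h3
        linarith
    have h2 : (δ - ε) ^ 2 ≤ ‖x - z₀‖ ^ 2 := by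
      have : 0 ≤ δ - ε := by linarith
      gcongr
    rw [hz, norm_sub_midpoint_sq, hy₀z₀, hs]
    nlinarith [sq_nonneg ε]
  obtain ⟨⟨hb1, hb2, hb3⟩, hεδ⟩ := hε₁' (y := ε) (by
    rw [Real.dist_eq, sub_zero, abs_of_pos hε]; exact hεε₁)
  set b := s - δ * ε with hb
  have hb0 : 0 < b := by linarith
  have hbx : ∀ x ∈ Ω ∪ strip Ω ε, b ≤ ‖x - z‖ ^ 2 := fun x hx => by
    have := hgeo x hx
    have : 0 ≤ ‖x - y₀‖ ^ 2 / 2 := by positivity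
    linarith
  -- The additive constant makes `w ≥ a` on all of `Ω ∪ Γ_ε`, since `|x - z|² ≥ b`.
  set w := barrier (a + C * b⁻¹ ^ k) C k z with hw
  have hwge : ∀ x ∈ Ω ∪ strip Ω ε, a ≤ w x := by
    intro x hx
    have h1 : (‖x - z‖ ^ 2)⁻¹ ^ k ≤ b⁻¹ ^ k := by
      have := hbx x hx
      gcongr
    have := mul_le_mul_of_nonneg_left h1 hC0
    simp only [hw, barrier]; linarith
  set Mw := |a + C * b⁻¹ ^ k| + |C| * b⁻¹ ^ k with hMw
  have hwabs : ∀ x ∈ Ω ∪ strip Ω ε, |w x| ≤ Mw := fun x hx =>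
    abs_barrier_le hb0 k (hbx x hx)
  obtain ⟨Mv, hMv⟩ := hv.bounded
  have hγε0 : 0 ≤ γ * ε ^ 2 := by positivity
  have hstrip : ∀ x ∈ strip Ω ε, v x ≤ w x := by
    intro x hx
    have hx' : x ∈ Ω ∪ strip Ω ε := Or.inr hx
    rw [hv.boundary x hx]
    rcases le_or_gt ρ₀ ‖x - y₀‖ with hfar | hnear
    · have h1 : b + t ≤ ‖x - z‖ ^ 2 := by
        have h2 : ρ₀ ^ 2 ≤ ‖x - y₀‖ ^ 2 := by gcongr
        have := hgeo x hx'
        rw [ht]; linarith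
      have h2 : (‖x - z‖ ^ 2)⁻¹ ^ k ≤ (b + t)⁻¹ ^ k := by gcongr
      have h3 : 2 * M ≤ C * (c / 2) := by
        have h4 : 4 * M / c * (c / 2) = 2 * M := by field_simp; ring
        have h5 : 0 ≤ 2 * γ * M * (R ^ 2) ^ (k + 1) * (c / 2) := by positivity
        rw [hC, add_mul, h4]; linarith
      have h4 : C * (c / 2) ≤ C * (b⁻¹ ^ k - (‖x - z‖ ^ 2)⁻¹ ^ k) := by
        apply mul_le_mul_of_nonneg_left _ hC0
        linarith
      have h5 := (abs_le.mp (hM x (strip_mono hεε₀ hx))).2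
      have h6 := (abs_le.mp hFy).1
      simp only [hw, barrier]
      rw [mul_sub] at h4
      linarith
    · refine le_trans ?_ (hwge x hx')
      have h1 := (abs_le.mp (hL x (strip_mono hεε₀ hx) y₀
        (frontier_subset_strip hΩo hε₀.le hy₀))).2
      have h2 : L * ‖x - y₀‖ ≤ (|L| + 1) * ρ₀ := by
        have : L ≤ |L| + 1 := by linarith [le_abs_self L]
        gcongr
      have h3 : (|L| + 1) * ρ₀ = η / 4 := by rw [hρ₀]; field_simp
      linarith
  have hmain : ∀ x ∈ Ω, v x ≤ w x := by
    refine comparison hn hp (q := 1 - γ * ε ^ 2) (M := max Mv Mw) hε (by linarith) (by linarith)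
      hΩb (fun x hx => hv.integrableOn_ball hΩo hx) (fun x hx => ?_) (fun x hx y hy => ?_)
      (fun x hx y hy => ?_) (fun x hx => (hv.eq_gameOp hx).le) (fun x hx => ?_)
      (fun x hx y hy hyΩ => ?_)
    · exact integrableOn_ball_of_measurable (measurable_barrier _ _ _ _) (M := Mw)
        fun y hy => hwabs y (ball_subset_union_strip hx ε hy)
    · exact (hMv y (ball_subset_union_strip hx ε hy)).trans (le_max_left _ _)
    · exact (hwabs y (ball_subset_union_strip hx ε hy)).trans (le_max_right _ _)
    · have hδr : δ / 2 ≤ ‖x - z‖ := by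
        have h1 := hzball x (subset_closure hx)
        have h2 : δ ^ 2 ≤ ‖x - z₀‖ ^ 2 := by gcongr
        have h3 := norm_sub_midpoint_sq x y₀ z₀
        rw [← hz, hy₀z₀] at h3
        have h4 : (δ / 2) ^ 2 = δ ^ 2 / 4 := by ring
        exact (sq_le_sq₀ (by positivity) (norm_nonneg _)).mp (by
          linarith [sq_nonneg ‖x - y₀‖])
      have hr0 : 0 < ‖x - z‖ := by linarith
      have hrR : ‖x - z‖ ≤ R := by rw [← dist_eq_norm]; exact hR hx
      have h1 := gameOp_barrier_le hn hp (a := a + C * b⁻¹ ^ k) hC0 hk1 hk hε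
        (by linarith : ε < ‖x - z‖)
      have h2 : 2 * γ * M ≤ C * (‖x - z‖ ^ 2)⁻¹ ^ (k + 1) := by
        have h3 : 1 ≤ (R ^ 2) ^ (k + 1) * (‖x - z‖ ^ 2)⁻¹ ^ (k + 1) := by
          rw [← mul_pow]
          refine one_le_pow₀ ?_
          rw [← div_eq_mul_inv, one_le_div (by positivity)]
          gcongr
        have h4 := mul_le_mul_of_nonneg_left h3 (by positivity : 0 ≤ 2 * γ * M)
        have h5 : 0 ≤ 4 * M / c * (‖x - z‖ ^ 2)⁻¹ ^ (k + 1) := by positivity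
        rw [hC, add_mul]; linarith
      have h3 := mul_le_mul_of_nonneg_left h1 (by linarith : 0 ≤ 1 - γ * ε ^ 2)
      refine h3.trans ?_
      change (1 - γ * ε ^ 2) * (w x - _) ≤ w x
      have h4 : -M ≤ w x := by
        have := hwge x (Or.inl hx)
        have := (abs_le.mp hFy).1
        -- Together with `w ≥ -M`, the following bound offsets the discount: `1 - γ ε² ≥ 1/2` is the
        -- reason for the factor `2` in `C`.
        linarith
      have h5 : 1 / 2 * (2 * γ * M * ε ^ 2) ≤
          (1 - γ * ε ^ 2) * (C * ε ^ 2 * (‖x - z‖ ^ 2)⁻¹ ^ (k + 1)) := by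
        have h6 := mul_le_mul_of_nonneg_right h2 (sq_nonneg ε)
        refine mul_le_mul (by linarith) (by linarith) (by positivity) (by linarith)
      have h6 := mul_le_mul_of_nonneg_left h4 hγε0
      rw [mul_sub]
      linarith
    · exact hstrip y ((ball_subset_union_strip hx ε hy).resolve_left hyΩ)
  intro x hx hxy
  have h1 : v x ≤ w x := hx.elim (hmain x) (hstrip x)
  have h2 := hρ' hxy
  simp only [hw, barrier] at h1
  linarith

theorem neg_lipschitz_on_strip {ε₀ L : ℝ} {F : E n → ℝ}
    (hL : ∀ x ∈ strip Ω ε₀, ∀ z ∈ strip Ω ε₀, |F x - F z| ≤ L * ‖x - z‖) :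
    ∀ x ∈ strip Ω ε₀, ∀ z ∈ strip Ω ε₀, |-F x - -F z| ≤ L * ‖x - z‖ := by
  intro x hx z hz
  rw [neg_sub_neg, abs_sub_comm]
  exact hL x hx z hz

theorem boundary_estimate (hn : 1 ≤ n) (hp : 2 < p) (hγ : 0 ≤ γ) (hΩo : IsOpen Ω)
    (hΩb : Bornology.IsBounded Ω) (hΩs : ExteriorSphere Ω) {ε₀ L : ℝ} (hε₀ : 0 < ε₀)
    {F : E n → ℝ}
    (hL : ∀ x ∈ strip Ω ε₀, ∀ z ∈ strip Ω ε₀, |F x - F z| ≤ L * ‖x - z‖)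
    {y₀ : E n} (hy₀ : y₀ ∈ frontier Ω) {η : ℝ} (hη : 0 < η) :
    ∃ ρ > 0, ∃ ε₁ > 0, ∀ ε v, 0 < ε → ε < ε₁ → ε ≤ ε₀ → γ * ε ^ 2 < 1 / 2 →
      IsDPPSolution Ω p γ ε F v →
      ∀ x ∈ Ω ∪ strip Ω ε, dist x y₀ < ρ → |v x - F y₀| ≤ η := by
  obtain ⟨ρ, hρ, ε₁, hε₁, h⟩ := boundary_upper hn hp hγ hΩo hΩb hΩs hε₀ hL hy₀ hη
  obtain ⟨ρ', hρ', ε₁', hε₁', h'⟩ := boundary_upper hn hp hγ hΩo hΩb hΩs hε₀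
    (neg_lipschitz_on_strip hL) hy₀ hη
  refine ⟨min ρ ρ', lt_min hρ hρ', min ε₁ ε₁', lt_min hε₁ hε₁',
    fun ε v hε hεε₁ hεε₀ hγε hv x hx hxy => ?_⟩
  have h1 := h ε v hε (hεε₁.trans_le (min_le_left _ _)) hεε₀ hγε hv x hx
    (hxy.trans_le (min_le_left _ _))
  have h2 := h' ε _ hε (hεε₁.trans_le (min_le_right _ _)) hεε₀ hγε hv.neg x hx
    (hxy.trans_le (min_le_right _ _))
  rw [abs_le]; constructor <;> linarith

/-- The boundary estimate with constants independent of the boundary point. -/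
theorem uniform_boundary_estimate (hn : 1 ≤ n) (hp : 2 < p) (hγ : 0 ≤ γ) (hΩo : IsOpen Ω)
    (hΩb : Bornology.IsBounded Ω) (hΩs : ExteriorSphere Ω) {ε₀ L : ℝ} (hε₀ : 0 < ε₀)
    {F : E n → ℝ}
    (hL : ∀ x ∈ strip Ω ε₀, ∀ z ∈ strip Ω ε₀, |F x - F z| ≤ L * ‖x - z‖)
    {η : ℝ} (hη : 0 < η) :
    ∃ ρ > 0, ∃ ε₁ > 0, ∀ ε v, 0 < ε → ε < ε₁ → ε ≤ ε₀ → γ * ε ^ 2 < 1 / 2 →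
      IsDPPSolution Ω p γ ε F v → ∀ y₀ ∈ frontier Ω, ∀ x ∈ Ω ∪ strip Ω ε,
      ∀ y ∈ Ω ∪ strip Ω ε, dist x y₀ < ρ → dist y y₀ < ρ → |v x - v y| ≤ η := by
  choose! ρ hρ ε₁ hε₁ h using fun (y₀ : E n) (hy₀ : y₀ ∈ frontier Ω) =>
    boundary_estimate hn hp hγ hΩo hΩb hΩs hε₀ hL hy₀ (half_pos hη)
  have hK := isCompact_frontier_of_isBounded hΩb
  -- Half radii leave room: a point within the least half radius of `y₀` lies in the full ball of
  -- the centre covering `y₀`.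
  obtain ⟨T, hTsub, hT⟩ := hK.elim_nhds_subcover (fun y => Metric.ball y (ρ y / 2))
    fun y hy => Metric.ball_mem_nhds y (half_pos (hρ y hy))
  rcases T.eq_empty_or_nonempty with rfl | hTne
  · refine ⟨1, one_pos, 1, one_pos, fun ε v _ _ _ _ _ y₀ hy₀ => ?_⟩
    simpa using hT hy₀
  · obtain ⟨i, hi, hi'⟩ := T.exists_min_image (fun y => ρ y / 2) hTne
    obtain ⟨j, hj, hj'⟩ := T.exists_min_image ε₁ hTne
    refine ⟨ρ i / 2, half_pos (hρ i (hTsub i hi)), ε₁ j, hε₁ j (hTsub j hj),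
      fun ε v hε hεε₁ hεε₀ hγε hv y₀ hy₀ => ?_⟩
    obtain ⟨y', hy', hyy'⟩ := mem_iUnion₂.mp (hT hy₀)
    have key : ∀ x ∈ Ω ∪ strip Ω ε, dist x y₀ < ρ i / 2 → |v x - F y'| ≤ η / 2 := by
      intro x hx hxy
      refine h y' (hTsub y' hy') ε v hε (hεε₁.trans_le (hj' y' hy')) hεε₀ hγε hv x hx ?_
      have h1 := hi' y' hy'
      have h2 := dist_triangle x y₀ y'
      rw [Metric.mem_ball] at hyy'
      linarith
    intro x hx y hy hxy hyy
    have h1 := abs_le.mp (key x hx hxy)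
    have h2 := abs_le.mp (key y hy hyy)
    rw [abs_le]; constructor <;> linarith

end Boundary

/-! ### Asymptotic Arzelà–Ascoli -/

section Compactness

/-- A uniformly bounded, asymptotically equicontinuous sequence on a compact set has a uniformly
convergent subsequence with continuous limit. -/
theorem exists_subseq_tendstoUniformlyOn {X : Type*} [PseudoMetricSpace X] {K : Set X}
    (hK : IsCompact K) (hne : K.Nonempty) {f : ℕ → X → ℝ} {M : ℝ}
    (hb : ∀ k, ∀ x ∈ K, |f k x| ≤ M)
    (heq : ∀ η > 0, ∃ r > 0, ∃ N : ℕ, ∀ k ≥ N, ∀ x ∈ K, ∀ y ∈ K, dist x y < r →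
      |f k x - f k y| ≤ η) :
    ∃ (u : X → ℝ) (s : ℕ → ℕ), StrictMono s ∧
      TendstoUniformlyOn (fun k => f (s k)) u atTop K ∧ ContinuousOn u K := by
  have : Nonempty K := hne.to_subtype
  have : CompactSpace K := isCompact_iff_compactSpace.mp hK
  set d : ℕ → K := TopologicalSpace.denseSeq K
  have hd : DenseRange d := TopologicalSpace.denseRange_denseSeq K
  -- Compactness of `[-M, M]^ℕ` replaces the diagonal argument on a dense sequence.
  have hpi : IsCompact (univ.pi fun _ : ℕ => Icc (-M) M) :=
    isCompact_univ_pi fun _ => isCompact_Icc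
  obtain ⟨l, -, s, hs, hl⟩ := hpi.tendsto_subseq (x := fun k i => f k (d i))
    fun k i _ => abs_le.mp (hb k (d i) (d i).2)
  rw [tendsto_pi_nhds] at hl
  have hcauchy : UniformCauchySeqOn (fun k => f (s k)) atTop K := by
    rw [Metric.uniformCauchySeqOn_iff]
    intro η hη
    obtain ⟨r, hr, N, hN⟩ := heq (η / 6) (by positivity)
    obtain ⟨T, hT⟩ := hK.elim_finite_subcover (fun i => Metric.ball (d i : X) r)
      (fun _ => Metric.isOpen_ball) (by
        intro x hx
        obtain ⟨i, hi⟩ := hd.exists_dist_lt ⟨x, hx⟩ hr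
        exact mem_iUnion.mpr ⟨i, hi⟩)
    have hev : ∀ᶠ k in atTop, ∀ i ∈ T, |f (s k) (d i) - l i| < η / 6 := by
      rw [Finset.eventually_all]
      intro i _
      have := Metric.tendsto_nhds.mp (hl i) (η / 6) (by positivity)
      simpa [Real.dist_eq] using this
    obtain ⟨N', hN'⟩ := eventually_atTop.mp hev
    have key : ∀ k ≥ max N N', ∀ i ∈ T, ∀ x ∈ K, dist x (d i) < r →
        |f (s k) x - l i| < η / 3 := by
      intro k hk i hi x hx hxi
      have h1 := hN (s k) ((le_of_max_le_left hk).trans (hs.id_le k)) x hx (d i) (d i).2 hxi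
      have h2 := hN' k (le_of_max_le_right hk) i hi
      have h3 := abs_sub_le (f (s k) x) (f (s k) (d i)) (l i)
      linarith
    refine ⟨max N N', fun a ha b hb x hx => ?_⟩
    obtain ⟨i, hi, hxi⟩ := mem_iUnion₂.mp (hT hx)
    have h1 := key a ha i hi x hx hxi
    have h2 := key b hb i hi x hx hxi
    have h3 := abs_sub_le (f (s a) x) (l i) (f (s b) x)
    rw [abs_sub_comm (l i)] at h3
    rw [Real.dist_eq]; linarith
  have hex : ∀ x, ∃ c, x ∈ K → Tendsto (fun k => f (s k) x) atTop (𝓝 c) := by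
    intro x
    by_cases hx : x ∈ K
    · obtain ⟨c, hc⟩ := cauchySeq_tendsto_of_complete (hcauchy.cauchySeq hx)
      exact ⟨c, fun _ => hc⟩
    · exact ⟨0, fun h => absurd h hx⟩
  choose u hu using hex
  refine ⟨u, s, hs, hcauchy.tendstoUniformlyOn_of_tendsto hu, ?_⟩
  rw [Metric.continuousOn_iff]
  intro x hx η hη
  obtain ⟨r, hr, N, hN⟩ := heq (η / 2) (by positivity)
  refine ⟨r, hr, fun y hy hyx => ?_⟩
  rw [Real.dist_eq]
  have hlim := ((hu y hy).sub (hu x hx)).abs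
  have hle : |u y - u x| ≤ η / 2 := by
    refine le_of_tendsto hlim ?_
    filter_upwards [eventually_ge_atTop N] with k hk
    exact hN (s k) (hk.trans (hs.id_le k)) y hy x hx hyx
  linarith

end Compactness

/-! ### From the boundary to the interior by translation -/

section Equicontinuity

variable {n : ℕ} {Ω : Set (E n)} {p γ : ℝ}

theorem gameOp_translate (p ε : ℝ) (v : E n → ℝ) (h x : E n) :
    gameOp p ε (fun z => v (z + h)) x = gameOp p ε v (x + h) := by
  have h1 : (fun z => v (z + h)) '' Metric.ball x ε = v '' Metric.ball (x + h) ε := by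
    have : Metric.ball (x + h) ε = (fun z => z + h) '' Metric.ball x ε := by simp
    rw [this, image_image]
  have h2 : ∫ y in Metric.ball x ε, v (y + h) = ∫ y in Metric.ball (x + h) ε, v y := by
    have h3 := setIntegral_ball_sub_center (fun y => v (y + (x + h))) x ε
    have h4 := setIntegral_ball_sub_center (fun y => v (y + (x + h))) (x + h) ε
    simp only [sub_add_cancel] at h4
    rw [h4, ← h3]
    congr 1; ext y; congr 1; abel
  unfold gameOp
  rw [h1, setAverage_eq, setAverage_eq, h2]
  rw [measureReal_def, measureReal_def, Measure.addHaar_ball_center,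
    Measure.addHaar_ball_center volume (x + h)]

theorem mem_of_lt_infDist_frontier {x y : E n} {r : ℝ} (hx : x ∈ Ω)
    (hr : r < Metric.infDist x (frontier Ω)) (hxy : dist x y ≤ r) : y ∈ Ω := by
  by_contra hy
  obtain ⟨z, hz, hxz, -⟩ := exists_mem_frontier_dist_le hx hy
  linarith [Metric.infDist_le_dist_of_mem (x := x) hz]

/-- The equation is translation invariant, so `v(· + h)` may be compared with `v + η` at depth more
than `ρ/2`; at smaller depth the boundary estimate already orders them. -/
theorem equicontinuity_upper (hn : 1 ≤ n) (hp : 2 < p) (hγ : 0 ≤ γ) (hΩo : IsOpen Ω)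
    (hΩb : Bornology.IsBounded Ω) (hfn : (frontier Ω).Nonempty) {F : E n → ℝ} {ε ρ η : ℝ}
    {v : E n → ℝ} (hε : 0 < ε) (hερ : ε < ρ / 4) (hγε : γ * ε ^ 2 < 1 / 2) (hη : 0 ≤ η)
    (hv : IsDPPSolution Ω p γ ε F v)
    (hbd : ∀ y₀ ∈ frontier Ω, ∀ x ∈ Ω ∪ strip Ω ε,
      ∀ y ∈ Ω ∪ strip Ω ε, dist x y₀ < ρ → dist y y₀ < ρ → |v x - v y| ≤ η)
    {x y : E n} (hx : x ∈ closure Ω) (hy : y ∈ closure Ω) (hxy : dist x y < ρ / 4) :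
    v y ≤ v x + η := by
  have hρ : 0 < ρ := by linarith
  have hK := isCompact_frontier_of_isBounded hΩb
  have hcl := closure_subset_union_strip hΩo hε.le
  have hnear : ∀ a ∈ Ω ∪ strip Ω ε, ∀ b ∈ Ω ∪ strip Ω ε,
      Metric.infDist a (frontier Ω) ≤ ρ / 2 → dist a b < ρ / 4 → v b ≤ v a + η := by
    intro a ha b hb hd hab
    obtain ⟨y₀, hy₀, hay⟩ := hK.exists_infDist_eq_dist hfn a
    have h1 := dist_triangle b a y₀
    rw [dist_comm b a] at h1
    have := abs_le.mp (hbd y₀ hy₀ a ha b hb (by linarith) (by linarith))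
    linarith
  set A : Set (E n) := {z | z ∈ Ω ∧ ρ / 2 < Metric.infDist z (frontier Ω)} with hA
  by_cases hxA : x ∈ A
  swap
  · refine hnear x (hcl hx) y (hcl hy) ?_ hxy
    rcases hcl hx with h | h
    · by_contra! hcon
      exact hxA ⟨h, hcon⟩
    · linarith [h.2]
  set h := y - x with hh
  have hhn : ‖h‖ < ρ / 4 := by rwa [hh, ← dist_eq_norm, dist_comm]
  have hzh : ∀ z : E n, dist z (z + h) < ρ / 4 := fun z => by simpa using hhn
  have hAh : ∀ z ∈ A, z + h ∈ Ω := fun z hz =>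
    mem_of_lt_infDist_frontier hz.1 hz.2 ((hzh z).le.trans (by linarith))
  have hAball : ∀ z ∈ A, ∀ w ∈ Metric.ball z ε, w ∈ Ω := fun z hz w hw =>
    mem_of_lt_infDist_frontier hz.1 hz.2 ((Metric.mem_ball'.mp hw).le.trans (by linarith))
  have hshift : ∀ z w : E n, w ∈ Metric.ball z ε → w + h ∈ Metric.ball (z + h) ε := by
    intro z w hw; simpa using hw
  obtain ⟨M, hM⟩ := hv.bounded
  have hγε0 : 0 ≤ γ * ε ^ 2 := by positivity
  have hM0 : ∀ z ∈ A, ∀ w ∈ Metric.ball z ε, |v w + η| ≤ M + η := fun z hz w hw => by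
    refine (abs_add_le _ _).trans ?_
    rw [abs_of_nonneg hη]
    gcongr
    exact hM w (Or.inl (hAball z hz w hw))
  have hvi : ∀ z ∈ A, IntegrableOn (fun w => v w + η) (Metric.ball z ε) := fun z hz =>
    (hv.integrableOn_ball hΩo hz.1).add (continuous_integrableOn_ball continuous_const z ε)
  have hcomp := comparison hn hp (q := 1 - γ * ε ^ 2) (M := M + η) hε (by linarith)
    (by linarith) (A := A) (hΩb.subset fun z hz => hz.1) (u := fun z => v (z + h))
    (w := fun z => v z + η) (fun z hz => ?_) hvi (fun z hz w hw => ?_) hM0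
    (fun z hz => ?_) (fun z hz => ?_) (fun z hz w hw hwA => ?_) x hxA
  · simpa [hh] using hcomp
  · have h1 := hv.integrableOn_ball hΩo (hAh z hz)
    have h2 := (measurePreserving_add_right (volume : Measure (E n)) h).integrableOn_comp_preimage
      (MeasurableEquiv.addRight h).measurableEmbedding (f := v) (s := Metric.ball (z + h) ε)
    have h3 : (fun w : E n => w + h) ⁻¹' Metric.ball (z + h) ε = Metric.ball z ε := by
      ext w; simp
    rw [h3] at h2
    exact h2.mpr h1
  · have := hM (w + h) (ball_subset_union_strip (hAh z hz) ε (hshift z w hw))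
    linarith
  · rw [gameOp_translate]
    exact (hv.eq_gameOp (hAh z hz)).le
  -- Adding `η ≥ 0` to a solution gives a supersolution, since the discount sends `η` to at most
  -- `η`.
  · have h1 := gameOp_mono_add hp hε (hvi z hz) (hv.integrableOn_ball hΩo hz.1) (hM0 z hz)
      (fun w hw => (hM w (Or.inl (hAball z hz w hw))).trans (by linarith))
      (m := η) fun w _ => le_rfl
    have h2 := mul_le_mul_of_nonneg_left h1 (by linarith : 0 ≤ 1 - γ * ε ^ 2)
    have h3 := hv.eq_gameOp hz.1
    have h4 := mul_le_mul_of_nonneg_right (by linarith : 1 - γ * ε ^ 2 ≤ 1) hη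
    linarith
  · have hwΩ := hAball z hz w hw
    refine hnear w (Or.inl hwΩ) (w + h)
      (ball_subset_union_strip (hAh z hz) ε (hshift z w hw)) ?_ (hzh w)
    by_contra! hcon
    exact hwA ⟨hwΩ, hcon⟩

theorem equicontinuity (hn : 1 ≤ n) (hp : 2 < p) (hγ : 0 ≤ γ) (hΩo : IsOpen Ω)
    (hΩb : Bornology.IsBounded Ω) (hΩs : ExteriorSphere Ω) (hfn : (frontier Ω).Nonempty)
    {ε₀ L : ℝ} (hε₀ : 0 < ε₀) {F : E n → ℝ}
    (hL : ∀ x ∈ strip Ω ε₀, ∀ z ∈ strip Ω ε₀, |F x - F z| ≤ L * ‖x - z‖)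
    {η : ℝ} (hη : 0 < η) :
    ∃ r > 0, ∃ ε₁ > 0, ∀ ε v, 0 < ε → ε < ε₁ → ε ≤ ε₀ → γ * ε ^ 2 < 1 / 2 →
      IsDPPSolution Ω p γ ε F v → ∀ x ∈ closure Ω, ∀ y ∈ closure Ω, dist x y < r →
      |v x - v y| ≤ η := by
  obtain ⟨ρ, hρ, ε₁, hε₁, h⟩ := uniform_boundary_estimate hn hp hγ hΩo hΩb hΩs hε₀ hL hη
  refine ⟨ρ / 4, by positivity, min ε₁ (ρ / 4), lt_min hε₁ (by positivity),
    fun ε v hε hεε₁ hεε₀ hγε hv x hx y hy hxy => ?_⟩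
  have hbd := h ε v hε (hεε₁.trans_le (min_le_left _ _)) hεε₀ hγε hv
  have hερ := hεε₁.trans_le (min_le_right _ _)
  have h1 := equicontinuity_upper hn hp hγ hΩo hΩb hfn hε hερ hγε hη.le hv hbd hx hy hxy
  have h2 := equicontinuity_upper hn hp hγ hΩo hΩb hfn hε hερ hγε hη.le hv hbd hy hx
    (by rwa [dist_comm])
  rw [abs_le]; constructor <;> linarith

end Equicontinuity

/-! ### The game operator on quadratic polynomials -/

section Quadratic

variable {n : ℕ}

/-- The quadratic polynomial with value `a`, gradient `ξ` and Hessian `A` at `x`. -/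
def quad (a : ℝ) (ξ : E n) (A : E n →L[ℝ] E n) (x y : E n) : ℝ :=
  a + inner ℝ ξ (y - x) + 1 / 2 * inner ℝ (A (y - x)) (y - x)

theorem continuous_quad (a : ℝ) (ξ : E n) (A : E n →L[ℝ] E n) (x : E n) :
    Continuous (quad a ξ A x) := by
  unfold quad; fun_prop

theorem quad_self (a : ℝ) (ξ : E n) (A : E n →L[ℝ] E n) (x : E n) : quad a ξ A x x = a := by
  simp [quad]

theorem quad_recenter (a : ℝ) (ξ : E n) {A : E n →L[ℝ] E n}
    (hA : (A : E n →ₗ[ℝ] E n).IsSymmetric) (x x' y : E n) :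
    quad a ξ A x y = quad (quad a ξ A x x') (ξ + A (x' - x)) A x' y := by
  have h1 : y - x = (y - x') + (x' - x) := by abel
  have h2 : (inner ℝ (A (y - x')) (x' - x) : ℝ) = inner ℝ (A (x' - x)) (y - x') := by
    rw [real_inner_comm]
    exact (hA _ _).symm
  unfold quad
  rw [h1, map_add]
  simp only [inner_add_left, inner_add_right, h2]
  ring

theorem isSymmetric_add_smul_id {A : E n →L[ℝ] E n} (hA : (A : E n →ₗ[ℝ] E n).IsSymmetric)
    (c : ℝ) :
    ((A + c • ContinuousLinearMap.id ℝ (E n) : E n →L[ℝ] E n) : E n →ₗ[ℝ] E n).IsSymmetric := by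
  intro u w
  have := hA u w
  simp only [ContinuousLinearMap.coe_coe] at this
  simp [inner_add_left, inner_add_right, inner_smul_left, inner_smul_right, this]

theorem inner_add_smul_id (A : E n →L[ℝ] E n) (c : ℝ) (h : E n) :
    (inner ℝ ((A + c • ContinuousLinearMap.id ℝ (E n)) h) h : ℝ) =
      inner ℝ (A h) h + c * ‖h‖ ^ 2 := by
  simp [inner_add_left, inner_smul_left]

theorem trace_add_smul_id (A : E n →L[ℝ] E n) (c : ℝ) :
    LinearMap.trace ℝ (E n) ((A + c • ContinuousLinearMap.id ℝ (E n) : E n →L[ℝ] E n)) =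
      LinearMap.trace ℝ (E n) A + c * n := by
  rw [ContinuousLinearMap.toLinearMap_add, map_add, trace_id_smul]

theorem quad_add_smul_id (a : ℝ) (ξ : E n) (A : E n →L[ℝ] E n) (c : ℝ) (x y : E n) :
    quad a ξ (A + c • ContinuousLinearMap.id ℝ (E n)) x y =
      quad a ξ A x y + c / 2 * ‖y - x‖ ^ 2 := by
  unfold quad
  rw [inner_add_smul_id]; ring

theorem abs_inner_apply_le (A : E n →L[ℝ] E n) {h : E n} (hh : ‖h‖ ≤ 1) :
    |(inner ℝ (A h) h : ℝ)| ≤ ‖A‖ := by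
  calc |(inner ℝ (A h) h : ℝ)| ≤ ‖A h‖ * ‖h‖ := abs_real_inner_le_norm _ _
    _ ≤ (‖A‖ * 1) * 1 := by gcongr; exact A.le_opNorm_of_le hh
    _ = ‖A‖ := by ring

/-- `ν` maximizes `⟨ξ, ω⟩ + ε/2 ⟨A ω, ω⟩` over the closed unit ball. -/
def IsBestDirection (ε : ℝ) (ξ : E n) (A : E n →L[ℝ] E n) (ν : E n) : Prop :=
  ‖ν‖ ≤ 1 ∧ ∀ ω : E n, ‖ω‖ ≤ 1 →
    (inner ℝ ξ ω + ε / 2 * inner ℝ (A ω) ω : ℝ) ≤ inner ℝ ξ ν + ε / 2 * inner ℝ (A ν) ν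

theorem exists_isBestDirection (ε : ℝ) (ξ : E n) (A : E n →L[ℝ] E n) :
    ∃ ν, IsBestDirection ε ξ A ν := by
  obtain ⟨ν, hν, h⟩ := (isCompact_closedBall (0 : E n) 1).exists_isMaxOn
    ⟨0, Metric.mem_closedBall_self zero_le_one⟩
    (f := fun ω => (inner ℝ ξ ω + ε / 2 * inner ℝ (A ω) ω : ℝ)) (by fun_prop)
  exact ⟨ν, by simpa using hν, fun ω hω => h (by simpa using hω)⟩

/-- The infimum is bounded by the value at the reflected point `x - εν`, so the first-order terms
cancel. -/
theorem gameOp_quad_le (hn : 1 ≤ n) {p : ℝ} (hp : 2 < p) {ε : ℝ} (hε : 0 < ε) (a : ℝ) (ξ : E n)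
    {A : E n →L[ℝ] E n} (hA : (A : E n →ₗ[ℝ] E n).IsSymmetric) (x : E n) {ν : E n}
    (hν : IsBestDirection ε ξ A ν) :
    gameOp p ε (quad a ξ A x) x ≤
      a + ε ^ 2 * (((p - 2) * inner ℝ (A ν) ν + LinearMap.trace ℝ (E n) A) / (2 * (p + n))) := by
  have hscale : ∀ (t : ℝ) (ω : E n), quad a ξ A x (x + t • ω) =
      a + t * inner ℝ ξ ω + t ^ 2 / 2 * inner ℝ (A ω) ω := by
    intro t ω
    unfold quad
    rw [add_sub_cancel_left, map_smul, inner_smul_right, inner_smul_right, real_inner_smul_left]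
    ring
  have hsup : sSup (quad a ξ A x '' Metric.ball x ε) ≤ quad a ξ A x (x + ε • ν) := by
    refine csSup_image_ball_le hε fun y hy => ?_
    have h1 : y = x + ε • (ε⁻¹ • (y - x)) := by rw [smul_inv_smul₀ hε.ne']; abel
    have h2 : ‖ε⁻¹ • (y - x)‖ ≤ 1 := by
      rw [norm_smul, Real.norm_eq_abs, abs_of_pos (inv_pos.mpr hε), inv_mul_le_iff₀ hε, mul_one,
        ← dist_eq_norm]
      exact (Metric.mem_ball.mp hy).le
    have h3 := mul_le_mul_of_nonneg_left (hν.2 _ h2) hε.le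
    rw [h1, hscale, hscale]
    linarith
  have hinf : sInf (quad a ξ A x '' Metric.ball x ε) ≤ quad a ξ A x (x + (-ε) • ν) := by
    refine csInf_image_ball_le hε (continuous_quad a ξ A x).continuousOn ?_
    rw [Metric.mem_closedBall, dist_eq_norm, add_sub_cancel_left, norm_smul, norm_neg,
      Real.norm_eq_abs, abs_of_pos hε]
    exact mul_le_of_le_one_right hε.le hν.1
  rw [hscale] at hsup hinf
  have havg : ⨍ y in Metric.ball x ε, quad a ξ A x y =
      a + ε ^ 2 / (2 * (n + 2)) * LinearMap.trace ℝ (E n) A :=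
    setAverage_ball_quadratic hn hA x ξ a hε
  have hα := alpha_nonneg (n := n) hp
  have h1 := mul_le_mul_of_nonneg_left (add_le_add hsup hinf)
    (by positivity : 0 ≤ (p - 2) / (p + n) / 2)
  unfold gameOp
  rw [havg]
  refine (add_le_add_left h1 _).trans (le_of_eq ?_)
  have hpn : p + n ≠ 0 := by positivity
  have hn2 : (n : ℝ) + 2 ≠ 0 := by positivity
  field_simp
  ring

/-- As the quadratic term fades, `ν` almost maximizes the linear form `⟨ξ, ·⟩`; with `|ν| ≤ 1` this
forces `|ν - e|² ≤ 2 - 2⟨e, ν⟩ → 0`, where `e = ξ/|ξ|`. -/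
theorem tendsto_bestDirection {ξ : E n} (hξ : ξ ≠ 0) {A : E n →L[ℝ] E n} {ε : ℕ → ℝ}
    (hε0 : ∀ k, 0 ≤ ε k) (hε : Tendsto ε atTop (𝓝 0)) {ξ' ν : ℕ → E n}
    (hξ' : Tendsto ξ' atTop (𝓝 ξ)) (hν : ∀ k, IsBestDirection (ε k) (ξ' k) A (ν k)) :
    Tendsto ν atTop (𝓝 (‖ξ‖⁻¹ • ξ)) := by
  have hξ0 : 0 < ‖ξ‖ := norm_pos_iff.mpr hξ
  set e := ‖ξ‖⁻¹ • ξ with he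
  have he1 : ‖e‖ = 1 := by
    rw [he, norm_smul, norm_inv, norm_norm, inv_mul_cancel₀ hξ0.ne']
  have hξe : ξ = ‖ξ‖ • e := by rw [he, smul_inv_smul₀ hξ0.ne']
  rw [tendsto_iff_norm_sub_tendsto_zero]
  have hbound : ∀ k, ‖ν k - e‖ ^ 2 ≤ 2 / ‖ξ‖ * (ε k * ‖A‖ + 2 * ‖ξ' k - ξ‖) := by
    intro k
    obtain ⟨hν1, hmax⟩ := hν k
    have h1 := hmax e he1.le
    have h2 := abs_le.mp (abs_inner_apply_le A hν1)
    have h3 := abs_le.mp (abs_inner_apply_le A he1.le)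
    have h4 : (inner ℝ (ξ' k) e : ℝ) - inner ℝ (ξ' k) (ν k) ≤ ε k * ‖A‖ := by
      have h5 := mul_le_mul_of_nonneg_left h2.2 (by linarith [hε0 k] : 0 ≤ ε k / 2)
      have h6 := mul_le_mul_of_nonneg_left h3.1 (by linarith [hε0 k] : 0 ≤ ε k / 2)
      linarith
    have h5 : (inner ℝ (ξ' k - ξ) (ν k - e) : ℝ) ≤ ‖ξ' k - ξ‖ * 2 := by
      refine (real_inner_le_norm _ _).trans ?_
      gcongr
      refine (norm_sub_le _ _).trans ?_
      linarith
    have h6 : (inner ℝ ξ e : ℝ) - inner ℝ ξ (ν k) ≤ ε k * ‖A‖ + 2 * ‖ξ' k - ξ‖ := by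
      simp only [inner_sub_left, inner_sub_right] at h5
      linarith
    have h7 : (inner ℝ ξ e : ℝ) = ‖ξ‖ := by
      rw [hξe, real_inner_smul_left, real_inner_self_eq_norm_sq, he1, norm_smul, he1]
      simp
    have h8 : (inner ℝ ξ (ν k) : ℝ) = ‖ξ‖ * inner ℝ e (ν k) := by
      conv_lhs => rw [hξe]
      rw [real_inner_smul_left]
    have h9 : ‖ν k - e‖ ^ 2 ≤ 2 - 2 * inner ℝ e (ν k) := by
      rw [norm_sub_sq_real, he1, real_inner_comm]
      have : ‖ν k‖ ^ 2 ≤ 1 := pow_le_one₀ (norm_nonneg _) hν1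
      linarith
    refine h9.trans ?_
    have h10 : 2 - 2 * (inner ℝ e (ν k) : ℝ) =
        2 / ‖ξ‖ * ((inner ℝ ξ e : ℝ) - inner ℝ ξ (ν k)) := by
      rw [h7, h8]; field_simp
    rw [h10]
    gcongr
  have hlim : Tendsto (fun k => 2 / ‖ξ‖ * (ε k * ‖A‖ + 2 * ‖ξ' k - ξ‖)) atTop (𝓝 0) := by
    have h1 := tendsto_iff_norm_sub_tendsto_zero.mp hξ'
    have h2 := ((hε.mul_const ‖A‖).add (h1.const_mul 2)).const_mul (2 / ‖ξ‖)
    simpa using h2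
  have hsq : Tendsto (fun k => ‖ν k - e‖ ^ 2) atTop (𝓝 0) :=
    squeeze_zero (fun k => by positivity) hbound hlim
  have := hsq.sqrt
  simpa [Real.sqrt_sq] using this

end Quadratic

/-! ### Passage to the limit at touching polynomials -/

section Touching

variable {n : ℕ} {Ω : Set (E n)} {p γ : ℝ}

/-- `u` is the uniform limit on `closure Ω` of solutions of the dynamic programming principle
with step sizes tending to zero. -/
structure IsGameLimit (Ω : Set (E n)) (p γ : ℝ) (u : E n → ℝ) : Prop where
  isOpen : IsOpen Ω
  continuousOn : ContinuousOn u Ω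
  approx : ∀ τ > 0, ∃ (ε : ℝ) (F v : E n → ℝ), 0 < ε ∧ ε < τ ∧ γ * ε ^ 2 < τ ∧
    IsDPPSolution Ω p γ ε F v ∧ ∀ x ∈ closure Ω, |v x - u x| < τ

theorem IsGameLimit.neg {u : E n → ℝ} (h : IsGameLimit Ω p γ u) :
    IsGameLimit Ω p γ fun x => -u x where
  isOpen := h.isOpen
  continuousOn := h.continuousOn.neg
  approx τ hτ := by
    obtain ⟨ε, F, v, h1, h2, h3, h4, h5⟩ := h.approx τ hτ
    refine ⟨ε, _, _, h1, h2, h3, h4.neg, fun x hx => ?_⟩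
    rw [neg_sub_neg, abs_sub_comm]
    exact h5 x hx

/-- Discrete inequality at an approximate maximum point of `v - P`, where `P` is a quadratic
polynomial touching the limit strictly from above. -/
theorem IsGameLimit.approx_inequality (hn : 1 ≤ n) (hp : 2 < p) (hγ : 0 ≤ γ)
    {u : E n → ℝ} (hu : IsGameLimit Ω p γ u) {x₀ ξ : E n} {A : E n →L[ℝ] E n}
    (hA : (A : E n →ₗ[ℝ] E n).IsSymmetric) {r η : ℝ} (hr : 0 < r) (hη : 0 < η)
    (hball : Metric.closedBall x₀ r ⊆ Ω)
    (htouch : ∀ x ∈ Metric.closedBall x₀ r, u x + η * ‖x - x₀‖ ^ 2 ≤ quad (u x₀) ξ A x₀ x)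
    {τ : ℝ} (hτ : 0 < τ) (hτ1 : τ ≤ 1) :
    ∃ (ε m : ℝ) (x ν : E n), 0 < ε ∧ ε < τ ∧ 0 ≤ γ * ε ^ 2 ∧ γ * ε ^ 2 < τ ∧ |m| ≤ τ ∧
      dist x x₀ < τ ∧ IsBestDirection ε (ξ + A (x - x₀)) A ν ∧
      γ * (quad (u x₀) ξ A x₀ x + m) - ε ≤ (1 - γ * ε ^ 2) *
        (((p - 2) * inner ℝ (A ν) ν + LinearMap.trace ℝ (E n) A) / (2 * (p + n))) := by
  set t := min τ (r / 2) with ht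
  have ht0 : 0 < t := lt_min hτ (by positivity)
  -- A near-maximizer satisfies `η|x - x₀|² < 3σ < ηt²`: two `σ` come from the closeness of `v` and
  -- `u`, one from the slack `ε³`.
  set σ := min t (η * t ^ 2 / 4) with hσ
  have hσ0 : 0 < σ := lt_min ht0 (by positivity)
  have hσt : σ ≤ t := min_le_left _ _
  have hσ2 : σ ≤ η * t ^ 2 / 4 := min_le_right _ _
  have htτ : t ≤ τ := min_le_left _ _
  have htr : t ≤ r / 2 := min_le_right _ _
  obtain ⟨ε, F, v, hε, hεσ, hγσ, hv, hclose⟩ := hu.approx σ hσ0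
  set P := quad (u x₀) ξ A x₀ with hP
  have hsub : Metric.closedBall x₀ r ⊆ closure Ω := hball.trans subset_closure
  have hx₀ : x₀ ∈ Metric.closedBall x₀ r := Metric.mem_closedBall_self hr.le
  have hupper : ∀ y ∈ Metric.closedBall x₀ r, v y - P y ≤ σ - η * ‖y - x₀‖ ^ 2 := by
    intro y hy
    have h1 := (abs_lt.mp (hclose y (hsub hy))).2
    linarith [htouch y hy]
  have hbdd : BddAbove ((fun y => v y - P y) '' Metric.closedBall x₀ r) := by
    refine ⟨σ, ?_⟩
    rintro _ ⟨y, hy, rfl⟩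
    have : 0 ≤ η * ‖y - x₀‖ ^ 2 := by positivity
    linarith [hupper y hy]
  set m := sSup ((fun y => v y - P y) '' Metric.closedBall x₀ r) with hm
  have hmle : ∀ y ∈ Metric.closedBall x₀ r, v y ≤ P y + m := fun y hy => by
    have := le_csSup hbdd (mem_image_of_mem _ hy)
    linarith
  have hmσ : m ≤ σ := by
    refine csSup_le ⟨_, mem_image_of_mem _ hx₀⟩ ?_
    rintro _ ⟨y, hy, rfl⟩
    have : 0 ≤ η * ‖y - x₀‖ ^ 2 := by positivity
    linarith [hupper y hy]
  have hmσ' : -σ ≤ m := by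
    have h1 := hmle x₀ hx₀
    have h2 := (abs_lt.mp (hclose x₀ (hsub hx₀))).1
    rw [hP, quad_self] at h1
    linarith
  have hε3 : 0 < ε ^ 3 := by positivity
  -- The supremum need not be attained; a slack of `ε³` vanishes even after division by `ε²`.
  obtain ⟨_, ⟨x, hx, rfl⟩, hxm⟩ := exists_lt_of_lt_csSup
    (⟨_, mem_image_of_mem _ hx₀⟩ :
      ((fun y => v y - P y) '' Metric.closedBall x₀ r).Nonempty)
    (by linarith : m - ε ^ 3 < m)
  simp only at hxm
  have hε1 : ε ≤ 1 := by linarith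
  have hε3' : ε ^ 3 ≤ ε := by
    calc ε ^ 3 ≤ ε ^ 1 := pow_le_pow_of_le_one hε.le hε1 (by norm_num)
      _ = ε := pow_one ε
  have hxt : ‖x - x₀‖ < t := by
    have h1 := hupper x hx
    have h2 : 0 < η * t ^ 2 := by positivity
    have h3 : η * ‖x - x₀‖ ^ 2 < η * t ^ 2 := by linarith
    exact lt_of_pow_lt_pow_left₀ 2 ht0.le (lt_of_mul_lt_mul_left h3 hη.le)
  have hxball : Metric.ball x ε ⊆ Metric.closedBall x₀ r := by
    intro y hy
    rw [Metric.mem_closedBall]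
    have h1 := dist_triangle y x x₀
    have h2 := Metric.mem_ball.mp hy
    rw [dist_eq_norm x x₀] at h1
    linarith
  have hxΩ : x ∈ Ω := hball hx
  obtain ⟨ν, hν⟩ := exists_isBestDirection ε (ξ + A (x - x₀)) A
  refine ⟨ε, m, x, ν, hε, by linarith, by positivity, by linarith,
    abs_le.mpr ⟨by linarith, by linarith⟩, by rw [dist_eq_norm]; linarith, hν, ?_⟩
  obtain ⟨Mv, hMv⟩ := hv.bounded
  have hPc : Continuous P := continuous_quad _ _ _ _
  obtain ⟨MP, hMP⟩ := (isCompact_closedBall x₀ r).exists_bound_of_continuousOn hPc.continuousOn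
  have h1 : gameOp p ε v x ≤ gameOp p ε P x + m :=
    gameOp_mono_add hp hε (M := max Mv MP) (hv.integrableOn_ball hu.isOpen hxΩ)
      (continuous_integrableOn_ball hPc x ε)
      (fun y hy => (hMv y (ball_subset_union_strip hxΩ ε hy)).trans (le_max_left _ _))
      (fun y hy => (hMP y (hxball hy)).trans (le_max_right _ _))
      fun y hy => hmle y (hxball hy)
  have h2 : gameOp p ε P x ≤ P x + ε ^ 2 *
      (((p - 2) * inner ℝ (A ν) ν + LinearMap.trace ℝ (E n) A) / (2 * (p + n))) := by
    have h3 : P = quad (P x) (ξ + A (x - x₀)) A x := by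
      ext y; exact quad_recenter _ _ hA _ _ _
    conv_lhs => rw [h3]
    exact gameOp_quad_le hn hp hε _ _ hA x hν
  set Q := ((p - 2) * inner ℝ (A ν) ν + LinearMap.trace ℝ (E n) A) / (2 * (p + n))
  have hq : 0 ≤ 1 - γ * ε ^ 2 := by linarith
  have h3 := mul_le_mul_of_nonneg_left (h1.trans (add_le_add_left h2 m)) hq
  rw [← hv.eq_gameOp hxΩ] at h3
  have hε2 : 0 < ε ^ 2 := by positivity
  refine le_of_mul_le_mul_left ?_ hε2
  have h4 : ε ^ 2 * (γ * (P x + m) - ε) = γ * ε ^ 2 * (P x + m) - ε ^ 3 := by ring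
  rw [h4]
  linarith

theorem IsGameLimit.exists_approx_seq (hn : 1 ≤ n) (hp : 2 < p) (hγ : 0 ≤ γ)
    {u : E n → ℝ} (hu : IsGameLimit Ω p γ u) {x₀ ξ : E n} {A : E n →L[ℝ] E n}
    (hA : (A : E n →ₗ[ℝ] E n).IsSymmetric) {r η : ℝ} (hr : 0 < r) (hη : 0 < η)
    (hball : Metric.closedBall x₀ r ⊆ Ω)
    (htouch : ∀ x ∈ Metric.closedBall x₀ r, u x + η * ‖x - x₀‖ ^ 2 ≤ quad (u x₀) ξ A x₀ x) :
    ∃ (ε a q : ℕ → ℝ) (ξ' ν : ℕ → E n), (∀ k, 0 ≤ ε k) ∧ Tendsto ε atTop (𝓝 0) ∧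
      Tendsto a atTop (𝓝 (γ * u x₀)) ∧ (∀ k, 0 ≤ q k) ∧ Tendsto q atTop (𝓝 1) ∧
      Tendsto ξ' atTop (𝓝 ξ) ∧ (∀ k, IsBestDirection (ε k) (ξ' k) A (ν k)) ∧
      ∀ k, a k ≤ q k *
        (((p - 2) * inner ℝ (A (ν k)) (ν k) + LinearMap.trace ℝ (E n) A) / (2 * (p + n))) := by
  set τ : ℕ → ℝ := fun k => 1 / ((k : ℝ) + 1) with hτ
  have hτ0 : ∀ k, 0 < τ k := fun k => by positivity
  have hτ1 : ∀ k, τ k ≤ 1 := fun k => by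
    rw [hτ]; simp only; rw [div_le_one (by positivity)]
    have : (0 : ℝ) ≤ k := Nat.cast_nonneg k
    linarith
  have hτlim : Tendsto τ atTop (𝓝 0) := tendsto_one_div_add_atTop_nhds_zero_nat
  choose ε m x ν h1 h2 h3 h4 h5 h6 h7 h8 using fun k =>
    hu.approx_inequality hn hp hγ hA hr hη hball htouch (hτ0 k) (hτ1 k)
  have hε : Tendsto ε atTop (𝓝 0) := squeeze_zero (fun k => (h1 k).le) (fun k => (h2 k).le) hτlim
  have hm : Tendsto m atTop (𝓝 0) := squeeze_zero_norm h5 hτlim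
  have hx : Tendsto x atTop (𝓝 x₀) := tendsto_iff_dist_tendsto_zero.mpr
    (squeeze_zero (fun k => dist_nonneg) (fun k => (h6 k).le) hτlim)
  have hq : Tendsto (fun k => 1 - γ * ε k ^ 2) atTop (𝓝 1) := by
    have := squeeze_zero h3 (fun k => (h4 k).le) hτlim
    simpa using this.const_sub 1
  refine ⟨ε, fun k => γ * (quad (u x₀) ξ A x₀ (x k) + m k) - ε k, fun k => 1 - γ * ε k ^ 2,
    fun k => ξ + A (x k - x₀), ν, fun k => (h1 k).le, hε, ?_, fun k => ?_, hq, ?_, h7, h8⟩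
  · have hP := ((continuous_quad (u x₀) ξ A x₀).tendsto x₀).comp hx
    rw [quad_self] at hP
    simpa using ((hP.add hm).const_mul γ).sub hε
  · linarith [h4 k, hτ1 k]
  · have : Continuous fun y : E n => ξ + A (y - x₀) := by fun_prop
    simpa [Function.comp_def] using (this.tendsto x₀).comp hx

theorem IsGameLimit.strict_of_ne_zero (hn : 1 ≤ n) (hp : 2 < p) (hγ : 0 ≤ γ)
    {u : E n → ℝ} (hu : IsGameLimit Ω p γ u) {x₀ ξ : E n} (hξ : ξ ≠ 0) {A : E n →L[ℝ] E n}
    (hA : (A : E n →ₗ[ℝ] E n).IsSymmetric) {r η : ℝ} (hr : 0 < r) (hη : 0 < η)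
    (hball : Metric.closedBall x₀ r ⊆ Ω)
    (htouch : ∀ x ∈ Metric.closedBall x₀ r, u x + η * ‖x - x₀‖ ^ 2 ≤ quad (u x₀) ξ A x₀ x) :
    2 * (p + n) * γ * u x₀ ≤
      (p - 2) * (inner ℝ (A ξ) ξ / ‖ξ‖ ^ 2) + LinearMap.trace ℝ (E n) A := by
  obtain ⟨ε, a, q, ξ', ν, hε0, hε, ha, -, hq, hξ', hν, hle⟩ :=
    hu.exists_approx_seq hn hp hγ hA hr hη hball htouch
  have hνlim := tendsto_bestDirection hξ hε0 hε hξ' hν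
  have hc : Continuous fun ω : E n =>
      (((p - 2) * inner ℝ (A ω) ω + LinearMap.trace ℝ (E n) A) / (2 * (p + n)) : ℝ) := by
    fun_prop
  have h1 := le_of_tendsto_of_tendsto' ha (hq.mul ((hc.tendsto _).comp hνlim)) hle
  have hpn : 0 < 2 * (p + n) := by positivity
  rw [one_mul, le_div_iff₀ hpn, map_smul, real_inner_smul_left, inner_smul_right] at h1
  have h2 : ‖ξ‖⁻¹ * (‖ξ‖⁻¹ * (inner ℝ (A ξ) ξ : ℝ)) = inner ℝ (A ξ) ξ / ‖ξ‖ ^ 2 := by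
    rw [div_eq_mul_inv, sq, mul_inv]; ring
  rw [h2] at h1
  linarith

/-- The sign of `μ` is needed because only `|ν| ≤ 1` is known, and `μ|ν|² ≤ μ` requires `μ ≥ 0`. -/
theorem IsGameLimit.strict_of_nonneg (hn : 1 ≤ n) (hp : 2 < p) (hγ : 0 ≤ γ)
    {u : E n → ℝ} (hu : IsGameLimit Ω p γ u) {x₀ ξ : E n} {A : E n →L[ℝ] E n}
    (hA : (A : E n →ₗ[ℝ] E n).IsSymmetric) {μ : ℝ} (hμ : 0 ≤ μ)
    (hAμ : ∀ h, inner ℝ (A h) h ≤ μ * ‖h‖ ^ 2) {r η : ℝ} (hr : 0 < r) (hη : 0 < η)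
    (hball : Metric.closedBall x₀ r ⊆ Ω)
    (htouch : ∀ x ∈ Metric.closedBall x₀ r, u x + η * ‖x - x₀‖ ^ 2 ≤ quad (u x₀) ξ A x₀ x) :
    2 * (p + n) * γ * u x₀ ≤ (p - 2) * μ + LinearMap.trace ℝ (E n) A := by
  obtain ⟨ε, a, q, ξ', ν, hε0, hε, ha, hq0, hq, hξ', hν, hle⟩ :=
    hu.exists_approx_seq hn hp hγ hA hr hη hball htouch
  have hpn : 0 < 2 * (p + n) := by positivity
  have hle' : ∀ k, a k ≤
      q k * (((p - 2) * μ + LinearMap.trace ℝ (E n) A) / (2 * (p + n))) := by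
    intro k
    refine (hle k).trans (mul_le_mul_of_nonneg_left ?_ (hq0 k))
    have h1 : inner ℝ (A (ν k)) (ν k) ≤ μ := (hAμ (ν k)).trans
      (mul_le_of_le_one_right hμ (pow_le_one₀ (norm_nonneg _) (hν k).1))
    have h2 : 0 ≤ p - 2 := by linarith
    gcongr
  have h1 := le_of_tendsto_of_tendsto' ha (hq.mul_const _) hle'
  rw [one_mul, le_div_iff₀ hpn] at h1
  linarith

/-- The second order superjet condition: `u` lies below the quadratic polynomial up to an error
of order `o(|y - x₀|²)`. -/
def TouchesBelow (u : E n → ℝ) (ξ : E n) (A : E n →L[ℝ] E n) (x₀ : E n) : Prop :=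
  ∀ η > 0, ∀ᶠ y in 𝓝 x₀, u y ≤ quad (u x₀) ξ A x₀ y + η * ‖y - x₀‖ ^ 2

/-- The enlarged Hessian adds `2η|x - x₀|²`: half absorbs the Taylor error, half gives strictness.
-/
theorem TouchesBelow.strict {u : E n → ℝ} {ξ x₀ : E n} {A : E n →L[ℝ] E n}
    (h : TouchesBelow u ξ A x₀) (hΩ : IsOpen Ω) (hx₀ : x₀ ∈ Ω) {η : ℝ} (hη : 0 < η) :
    ∃ r > 0, Metric.closedBall x₀ r ⊆ Ω ∧ ∀ x ∈ Metric.closedBall x₀ r,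
      u x + η * ‖x - x₀‖ ^ 2 ≤
        quad (u x₀) ξ (A + (4 * η) • ContinuousLinearMap.id ℝ (E n)) x₀ x := by
  obtain ⟨r, hr, hsub⟩ := Metric.nhds_basis_closedBall.eventually_iff.mp
    ((h η hη).and (hΩ.mem_nhds hx₀))
  refine ⟨r, hr, fun x hx => (hsub hx).2, fun x hx => ?_⟩
  rw [quad_add_smul_id]
  linarith [(hsub hx).1]

theorem IsGameLimit.le_of_ne_zero (hn : 1 ≤ n) (hp : 2 < p) (hγ : 0 ≤ γ)
    {u : E n → ℝ} (hu : IsGameLimit Ω p γ u) {x₀ ξ : E n} (hx₀ : x₀ ∈ Ω) (hξ : ξ ≠ 0)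
    {A : E n →L[ℝ] E n} (hA : (A : E n →ₗ[ℝ] E n).IsSymmetric) (h : TouchesBelow u ξ A x₀) :
    2 * (p + n) * γ * u x₀ ≤
      (p - 2) * (inner ℝ (A ξ) ξ / ‖ξ‖ ^ 2) + LinearMap.trace ℝ (E n) A := by
  refine le_of_forall_pos_le_add fun κ hκ => ?_
  have hpn : 0 < p - 2 + n := by have : (0 : ℝ) ≤ n := n.cast_nonneg; linarith
  set η := κ / (4 * (p - 2 + n)) with hη
  obtain ⟨r, hr, hball, htouch⟩ := h.strict hu.isOpen hx₀ (by positivity : 0 < η)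
  have h1 := hu.strict_of_ne_zero hn hp hγ hξ (isSymmetric_add_smul_id hA (4 * η)) hr
    (by positivity) hball htouch
  rw [trace_add_smul_id, inner_add_smul_id, add_div,
    mul_div_cancel_right₀ _ (by have := norm_pos_iff.mpr hξ; positivity)] at h1
  have h2 : 4 * η * (p - 2 + n) = κ := by rw [hη]; field_simp
  linarith

/-- A small linear term moves the contact to a nearby point where the gradient of the polynomial is
nonzero, so `le_of_ne_zero` applies there; continuity of `u` returns the inequality to `x₀`. -/
theorem IsGameLimit.strict_of_neg (hn : 1 ≤ n) (hp : 2 < p) (hγ : 0 ≤ γ)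
    {u : E n → ℝ} (hu : IsGameLimit Ω p γ u) {x₀ : E n} {A : E n →L[ℝ] E n}
    (hA : (A : E n →ₗ[ℝ] E n).IsSymmetric) {μ : ℝ} (hμ : μ < 0)
    (hAμ : ∀ h, inner ℝ (A h) h ≤ μ * ‖h‖ ^ 2) {r η : ℝ} (hr : 0 < r) (hη : 0 < η)
    (hball : Metric.closedBall x₀ r ⊆ Ω)
    (htouch : ∀ x ∈ Metric.closedBall x₀ r, u x + η * ‖x - x₀‖ ^ 2 ≤ quad (u x₀) 0 A x₀ x) :
    2 * (p + n) * γ * u x₀ ≤ (p - 2) * μ + LinearMap.trace ℝ (E n) A := by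
  have hx₀ : x₀ ∈ Metric.closedBall x₀ r := Metric.mem_closedBall_self hr.le
  have key : ∀ τ > 0, ∃ x, dist x x₀ < τ ∧
      2 * (p + n) * γ * u x ≤ (p - 2) * μ + LinearMap.trace ℝ (E n) A := by
    intro τ hτ
    -- Strict touching gives `η|x - x₀|² ≤ t|x - x₀|` at the maximizer, so this slope keeps it
    -- within half of `min τ r`.
    set t := η * min τ r / 2 with ht
    have hmin : 0 < min τ r := lt_min hτ hr
    have ht0 : 0 < t := by positivity
    set b : E n := t • EuclideanSpace.single ⟨0, hn⟩ 1 with hb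
    have hbt : ‖b‖ = t := by
      rw [hb, norm_smul, Real.norm_eq_abs, abs_of_pos ht0]; simp
    obtain ⟨x, hx, hmax⟩ := (isCompact_closedBall x₀ r).exists_isMaxOn ⟨x₀, hx₀⟩
      (f := fun y => u y - quad 0 b A x₀ y)
      ((hu.continuousOn.mono hball).sub (continuous_quad 0 b A x₀).continuousOn)
    have hmax' : ∀ y ∈ Metric.closedBall x₀ r, u y - quad 0 b A x₀ y ≤ u x - quad 0 b A x₀ x :=
      fun y hy => hmax hy
    have htx := htouch x hx
    have hxnorm : ‖x - x₀‖ ≤ t / η := by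
      have h1 := hmax' x₀ hx₀
      rw [quad_self] at h1
      have h2 := abs_real_inner_le_norm b (x - x₀)
      rw [hbt] at h2
      have h3 := (abs_le.mp h2).1
      simp only [quad, inner_zero_left] at h1 htx
      have h4 : η * ‖x - x₀‖ ^ 2 ≤ t * ‖x - x₀‖ := by linarith
      rw [le_div_iff₀ hη]
      rcases (norm_nonneg (x - x₀)).eq_or_lt with h0 | h0
      · rw [← h0, zero_mul]; exact ht0.le
      · refine le_of_mul_le_mul_right ?_ h0
        linarith
    have hteta : t / η = min τ r / 2 := by rw [ht]; field_simp
    rw [hteta] at hxnorm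
    -- A vanishing gradient would make `x` the peak of the concave polynomial; comparing with `x₀`
    -- then gives `0 ≤ μ|x - x₀|²`, hence `x = x₀`, where the gradient is `b ≠ 0`.
    have hξ : b + A (x - x₀) ≠ 0 := by
      intro h0
      have h1 := hmax' x₀ hx₀
      rw [quad_recenter 0 b hA x₀ x x₀, h0] at h1
      have h2 : (inner ℝ (A (x₀ - x)) (x₀ - x) : ℝ) ≤ μ * ‖x - x₀‖ ^ 2 := by
        rw [norm_sub_rev]; exact hAμ _
      have h3 := hAμ (x - x₀)
      simp only [quad, inner_zero_left] at h1 htx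
      have h4 : 0 ≤ η * ‖x - x₀‖ ^ 2 := by positivity
      have h5 : 0 ≤ μ * ‖x - x₀‖ ^ 2 := by linarith
      have h6 : ‖x - x₀‖ ^ 2 ≤ 0 := by
        by_contra! hcon
        exact absurd h5 (not_le.mpr (mul_neg_of_neg_of_pos hμ hcon))
      have h7 : x - x₀ = 0 := by
        rw [← norm_eq_zero]
        exact pow_eq_zero_iff two_ne_zero |>.mp (le_antisymm h6 (by positivity))
      rw [h7, map_zero, add_zero] at h0
      rw [h0, norm_zero] at hbt
      linarith
    have hxlt : dist x x₀ < min τ r := by rw [dist_eq_norm]; linarith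
    refine ⟨x, hxlt.trans_le (min_le_left _ _), ?_⟩
    have htouchx : TouchesBelow u (b + A (x - x₀)) A x := by
      intro κ hκ
      have hnhds : Metric.closedBall x₀ r ∈ 𝓝 x :=
        Filter.mem_of_superset (Metric.isOpen_ball.mem_nhds
          (Metric.mem_ball.mpr (hxlt.trans_le (min_le_right _ _)))) Metric.ball_subset_closedBall
      filter_upwards [hnhds] with y hy
      have h1 := hmax' y hy
      rw [quad_recenter 0 b hA x₀ x y] at h1
      have h2 : 0 ≤ κ * ‖y - x‖ ^ 2 := by positivity
      simp only [quad] at h1 ⊢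
      linarith
    refine (hu.le_of_ne_zero hn hp hγ (hball hx) hξ hA htouchx).trans ?_
    have h1 := hAμ (b + A (x - x₀))
    have h2 : 0 < ‖b + A (x - x₀)‖ ^ 2 := by have := norm_pos_iff.mpr hξ; positivity
    have h3 : inner ℝ (A (b + A (x - x₀))) (b + A (x - x₀)) / ‖b + A (x - x₀)‖ ^ 2 ≤ μ := by
      rwa [div_le_iff₀ h2]
    have h4 : 0 ≤ p - 2 := by linarith
    gcongr
  by_contra! hcon
  have hc : ContinuousAt u x₀ := hu.continuousOn.continuousAt (hu.isOpen.mem_nhds (hball hx₀))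
  have hev := (hc.tendsto.const_mul (2 * (p + n) * γ)).eventually_const_lt hcon
  obtain ⟨τ, hτ, hτ'⟩ := Metric.eventually_nhds_iff.mp hev
  obtain ⟨x, hx, hx'⟩ := key τ hτ
  exact absurd hx' (not_le.mpr (hτ' hx))

theorem IsGameLimit.le_of_eq_zero (hn : 1 ≤ n) (hp : 2 < p) (hγ : 0 ≤ γ)
    {u : E n → ℝ} (hu : IsGameLimit Ω p γ u) {x₀ : E n} (hx₀ : x₀ ∈ Ω)
    {A : E n →L[ℝ] E n} (hA : (A : E n →ₗ[ℝ] E n).IsSymmetric) {μ : ℝ}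
    (hAμ : ∀ h, inner ℝ (A h) h ≤ μ * ‖h‖ ^ 2) (h : TouchesBelow u 0 A x₀) :
    2 * (p + n) * γ * u x₀ ≤ (p - 2) * μ + LinearMap.trace ℝ (E n) A := by
  have hpn : 0 < p - 2 + n := by have : (0 : ℝ) ≤ n := n.cast_nonneg; linarith
  have key : ∀ η > 0, 2 * (p + n) * γ * u x₀ ≤
      (p - 2) * (μ + 4 * η) + (LinearMap.trace ℝ (E n) A + 4 * η * n) := by
    intro η hη
    obtain ⟨r, hr, hball, htouch⟩ := h.strict hu.isOpen hx₀ hη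
    have hAμ' : ∀ h, inner ℝ ((A + (4 * η) • ContinuousLinearMap.id ℝ (E n)) h) h ≤
        (μ + 4 * η) * ‖h‖ ^ 2 := fun h => by
      rw [inner_add_smul_id, add_mul]; linarith [hAμ h]
    rw [← trace_add_smul_id]
    rcases le_or_gt 0 (μ + 4 * η) with hc | hc
    · exact hu.strict_of_nonneg hn hp hγ (isSymmetric_add_smul_id hA _) hc hAμ' hr hη hball htouch
    · exact hu.strict_of_neg hn hp hγ (isSymmetric_add_smul_id hA _) hc hAμ' hr hη hball htouch
  refine le_of_forall_pos_le_add fun κ hκ => ?_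
  have h1 := key (κ / (4 * (p - 2 + n))) (by positivity)
  have h2 : 4 * (κ / (4 * (p - 2 + n))) * (p - 2 + n) = κ := by field_simp
  linarith

end Touching

/-! ### Hessians, Taylor expansion and extreme eigenvalues -/

section Hessian

variable {n : ℕ}

/-- The operator representing the second derivative of `φ` at `x`. -/
def hessOp (φ : E n → ℝ) (x : E n) : E n →L[ℝ] E n :=
  ∑ i, ((fderiv ℝ (fderiv ℝ φ) x).flip (EuclideanSpace.basisFun (Fin n) ℝ i)).smulRight
    (EuclideanSpace.basisFun (Fin n) ℝ i)

theorem inner_hessOp (φ : E n → ℝ) (x h k : E n) :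
    inner ℝ (hessOp φ x h) k = fderiv ℝ (fderiv ℝ φ) x h k := by
  set b := EuclideanSpace.basisFun (Fin n) ℝ
  conv_rhs => rw [← b.sum_repr' k, map_sum]
  simp only [hessOp, sum_apply, sum_inner,
    ContinuousLinearMap.smulRight_apply, ContinuousLinearMap.flip_apply, real_inner_smul_left,
    map_smul, smul_eq_mul]
  exact Finset.sum_congr rfl fun i _ => mul_comm _ _

theorem iteratedFDeriv_two_eq_inner_hessOp (φ : E n → ℝ) (x h k : E n) :
    iteratedFDeriv ℝ 2 φ x ![h, k] = inner ℝ (hessOp φ x h) k := by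
  rw [iteratedFDeriv_two_apply, inner_hessOp]
  rfl

theorem laplacian_eq_trace_hessOp (φ : E n → ℝ) (x : E n) :
    Laplacian.laplacian φ x = LinearMap.trace ℝ (E n) (hessOp φ x) := by
  rw [InnerProductSpace.laplacian_eq_iteratedFDeriv_orthonormalBasis φ
    (EuclideanSpace.basisFun (Fin n) ℝ), LinearMap.trace_eq_sum_inner _
    (EuclideanSpace.basisFun (Fin n) ℝ)]
  refine Finset.sum_congr rfl fun i _ => ?_
  rw [iteratedFDeriv_two_eq_inner_hessOp, real_inner_comm]
  rfl

theorem snd_fderiv_symm {φ : E n → ℝ} {x : E n} (hφ : ContDiffAt ℝ 2 φ x) (h k : E n) :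
    fderiv ℝ (fderiv ℝ φ) x h k = fderiv ℝ (fderiv ℝ φ) x k h :=
  (hφ.isSymmSndFDerivAt (by simp)).eq h k

theorem hessOp_isSymmetric {φ : E n → ℝ} {x : E n} (hφ : ContDiffAt ℝ 2 φ x) :
    (hessOp φ x : E n →ₗ[ℝ] E n).IsSymmetric := by
  intro h k
  simp only [ContinuousLinearMap.coe_coe]
  rw [inner_hessOp, real_inner_comm, inner_hessOp, snd_fderiv_symm hφ]

theorem inner_gradient (φ : E n → ℝ) (x h : E n) :
    inner ℝ (gradient φ x) h = fderiv ℝ φ x h := by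
  unfold gradient
  rw [InnerProductSpace.toDual_symm_apply]

/-- Second order Taylor expansion with Peano remainder. -/
theorem taylor_two {φ : E n → ℝ} {x₀ : E n} (hφ : ContDiffAt ℝ 2 φ x₀) {η : ℝ} (hη : 0 < η) :
    ∀ᶠ y in 𝓝 x₀, |φ y - quad (φ x₀) (gradient φ x₀) (hessOp φ x₀) x₀ y| ≤
      η * ‖y - x₀‖ ^ 2 := by
  set B := fderiv ℝ (fderiv ℝ φ) x₀ with hB
  have hd : HasFDerivAt (fderiv ℝ φ) B x₀ :=
    ((hφ.fderiv_right (m := 1) (by norm_num)).differentiableAt (by norm_num)).hasFDerivAt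
  have hlo := (hasFDerivAt_iff_isLittleO.mp hd).def hη
  have hdiff : ∀ᶠ y in 𝓝 x₀, DifferentiableAt ℝ φ y := by
    filter_upwards [hφ.eventually (by simp)] with y hy
    exact hy.differentiableAt (by norm_num)
  obtain ⟨r, hr, hsub⟩ := Metric.nhds_basis_ball.eventually_iff.mp (hlo.and hdiff)
  filter_upwards [Metric.ball_mem_nhds x₀ hr] with y hy
  -- The derivative of the remainder is `o(|z - x₀|)`, so the mean value inequality on a closed ball
  -- gives the quadratic bound.
  set ψ : E n → ℝ := fun z => φ z - (φ x₀ + fderiv ℝ φ x₀ (z - x₀) +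
    1 / 2 * B (z - x₀) (z - x₀)) with hψ
  have hcb : Metric.closedBall x₀ (dist y x₀) ⊆ Metric.ball x₀ r :=
    Metric.closedBall_subset_ball hy
  have hder : ∀ z ∈ Metric.closedBall x₀ (dist y x₀),
      HasFDerivWithinAt ψ (fderiv ℝ φ z - fderiv ℝ φ x₀ - B (z - x₀))
        (Metric.closedBall x₀ (dist y x₀)) z := by
    intro z hz
    have h1 := (hsub (hcb hz)).2.hasFDerivAt
    have hid : HasFDerivAt (fun z : E n => z - x₀) (ContinuousLinearMap.id ℝ (E n)) z :=
      (hasFDerivAt_id z).sub_const x₀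
    have h2 := (fderiv ℝ φ x₀).hasFDerivAt.comp z hid
    have h3 := (B.hasFDerivAt.comp z hid).clm_apply hid
    have h4 := h1.sub (((hasFDerivAt_const (φ x₀) z).add h2).add (h3.const_mul (1 / 2)))
    refine (h4.congr_fderiv ?_).hasFDerivWithinAt
    ext k
    have h5 : B k (z - x₀) = B (z - x₀) k := snd_fderiv_symm hφ _ _
    simp [-map_sub, h5]
    ring
  have hmv := (convex_closedBall x₀ (dist y x₀)).norm_image_sub_le_of_norm_hasFDerivWithin_le
    (C := η * dist y x₀) hder (fun z hz => ?_) (Metric.mem_closedBall_self dist_nonneg)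
    (Metric.mem_closedBall.mpr le_rfl)
  · have h0 : ψ x₀ = 0 := by simp [hψ]
    have h1 : φ y - quad (φ x₀) (gradient φ x₀) (hessOp φ x₀) x₀ y = ψ y := by
      simp only [hψ, quad, inner_gradient, inner_hessOp, hB]
    rw [h0, sub_zero, Real.norm_eq_abs, dist_eq_norm] at hmv
    rw [h1]
    linarith
  · refine (hsub (hcb hz)).1.trans ?_
    rw [← dist_eq_norm]
    have := Metric.mem_closedBall.mp hz
    gcongr

/-- The Rayleigh quotient of a Hessian is bounded by the largest eigenvalue. -/
theorem inner_hessOp_le_lambdaMax {φ : E n → ℝ} {x : E n} (hφ : ContDiffAt ℝ 2 φ x) (c : ℝ)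
    (h : E n) :
    c * inner ℝ (hessOp φ x h) h ≤ lambdaMax (c • hessian φ x) * ‖h‖ ^ 2 := by
  set T : E n →L[ℝ] E n := c • hessOp φ x with hT
  have hTs : (T : E n →ₗ[ℝ] E n).IsSymmetric := by
    intro u w
    have := hessOp_isSymmetric hφ u w
    simp only [ContinuousLinearMap.coe_coe] at this
    simp [hT, inner_smul_left, inner_smul_right, this]
  have hf : Module.finrank ℝ (E n) = n := finrank_euclideanSpace_fin
  have hmat : Matrix.toEuclideanLin (c • hessian φ x) = (T : E n →ₗ[ℝ] E n) := by
    refine (EuclideanSpace.basisFun (Fin n) ℝ).toBasis.ext fun j => ?_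
    refine (EuclideanSpace.basisFun (Fin n) ℝ).toBasis.ext_elem fun i => ?_
    have h1 : (inner ℝ (hessOp φ x (EuclideanSpace.single j 1)) (EuclideanSpace.single i 1) : ℝ) =
        inner ℝ (hessOp φ x (EuclideanSpace.single i 1)) (EuclideanSpace.single j 1) := by
      rw [inner_hessOp, inner_hessOp, snd_fderiv_symm hφ]
    have h2 : hessOp φ x (EuclideanSpace.single j 1) i = hessian φ x i j := by
      rw [hessian, Matrix.of_apply, iteratedFDeriv_two_eq_inner_hessOp, ← h1]
      simp [EuclideanSpace.inner_single_right]
    simp [hT, Matrix.toLpLin_apply, h2]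
  have hspec : ∀ i, hTs.eigenvalues hf i ∈ spectrum ℝ (c • hessian φ x) := by
    intro i
    rw [← Matrix.spectrum_toLpLin 2, hmat]
    exact (hTs.hasEigenvalue_eigenvalues hf i).mem_spectrum
  -- Finiteness of the spectrum makes its `sSup` a genuine upper bound.
  have hbdd : BddAbove (spectrum ℝ (c • hessian φ x)) :=
    (Matrix.finite_real_spectrum).bddAbove
  have h1 : c * inner ℝ (hessOp φ x h) h = inner ℝ (T h) h := by
    simp [hT, inner_smul_left]
  rw [h1, inner_apply_self_eq_sum hTs hf, ← (hTs.eigenvectorBasis hf).sum_sq_inner_right h,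
    Finset.mul_sum]
  refine Finset.sum_le_sum fun i _ => ?_
  exact mul_le_mul_of_nonneg_right (le_csSup hbdd (hspec i)) (sq_nonneg _)

theorem gradient_fun_neg (φ : E n → ℝ) (x : E n) :
    gradient (fun y => -φ y) x = -gradient φ x := by
  unfold gradient
  rw [fderiv_fun_neg, map_neg]

theorem iteratedFDeriv_two_fun_neg (φ : E n → ℝ) (x h k : E n) :
    iteratedFDeriv ℝ 2 (fun y => -φ y) x ![h, k] = -iteratedFDeriv ℝ 2 φ x ![h, k] := by
  have := iteratedFDeriv_neg_apply (𝕜 := ℝ) (i := 2) (f := φ) (x := x)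
  have h1 : (fun y => -φ y) = -φ := rfl
  rw [h1, this]
  rfl

theorem laplacian_fun_neg (φ : E n → ℝ) (x : E n) :
    Laplacian.laplacian (fun y => -φ y) x = -Laplacian.laplacian φ x := by
  rw [InnerProductSpace.laplacian_eq_iteratedFDeriv_orthonormalBasis _
    (EuclideanSpace.basisFun (Fin n) ℝ),
    InnerProductSpace.laplacian_eq_iteratedFDeriv_orthonormalBasis φ
    (EuclideanSpace.basisFun (Fin n) ℝ)]
  simp only [iteratedFDeriv_two_fun_neg, Finset.sum_neg_distrib]

theorem hessian_fun_neg (φ : E n → ℝ) (x : E n) :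
    hessian (fun y => -φ y) x = -hessian φ x := by
  ext i j
  simp only [hessian, Matrix.of_apply, Matrix.neg_apply, iteratedFDeriv_two_fun_neg]

theorem lambdaMax_neg (X : Matrix (Fin n) (Fin n) ℝ) : lambdaMax (-X) = -lambdaMin X := by
  rw [lambdaMax, lambdaMin, ← spectrum.neg_eq, Real.sSup_neg]

theorem normPLaplacian_fun_neg (p : ℝ) (φ : E n → ℝ) (x : E n) :
    normPLaplacian p (fun y => -φ y) x = -normPLaplacian p φ x := by
  unfold normPLaplacian
  rw [laplacian_fun_neg, gradient_fun_neg, iteratedFDeriv_two_fun_neg, norm_neg,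
    iteratedFDeriv_two_eq_inner_hessOp, iteratedFDeriv_two_eq_inner_hessOp, map_neg,
    inner_neg_neg]
  ring

end Hessian

/-! ### Viscosity property and convergence -/

section Limit

variable {n : ℕ} {Ω : Set (E n)} {p γ : ℝ}

theorem IsGameLimit.above (hn : 1 ≤ n) (hp : 2 < p) (hγ : 0 ≤ γ) {u : E n → ℝ}
    (hu : IsGameLimit Ω p γ u) {φ : E n → ℝ} {x₀ : E n} (hx₀ : x₀ ∈ Ω)
    (hφ : ContDiffOn ℝ 2 φ Ω) (heq : φ x₀ = u x₀) (hle : ∀ᶠ x in 𝓝 x₀, u x ≤ φ x) :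
    (gradient φ x₀ ≠ 0 → 2 * (p + n) * γ * φ x₀ ≤ normPLaplacian p φ x₀) ∧
    (gradient φ x₀ = 0 → 2 * (p + n) * γ * φ x₀ ≤
      lambdaMax ((p - 2) • hessian φ x₀) + Laplacian.laplacian φ x₀) := by
  have hφ' : ContDiffAt ℝ 2 φ x₀ := hφ.contDiffAt (hu.isOpen.mem_nhds hx₀)
  have hA := hessOp_isSymmetric hφ'
  have htouch : TouchesBelow u (gradient φ x₀) (hessOp φ x₀) x₀ := by
    intro η hη
    filter_upwards [taylor_two hφ' hη, hle] with y h1 h2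
    rw [← heq]
    linarith [(abs_le.mp h1).2]
  rw [laplacian_eq_trace_hessOp, heq]
  refine ⟨fun hξ => ?_, fun hξ => ?_⟩
  · have := hu.le_of_ne_zero hn hp hγ hx₀ hξ hA htouch
    rw [normPLaplacian, laplacian_eq_trace_hessOp, iteratedFDeriv_two_eq_inner_hessOp]
    linarith
  · rw [hξ] at htouch
    have hp2 : 0 < p - 2 := by linarith
    have := hu.le_of_eq_zero hn hp hγ hx₀ hA
      (μ := lambdaMax ((p - 2) • hessian φ x₀) / (p - 2)) (fun h => by
        have h1 := inner_hessOp_le_lambdaMax hφ' (p - 2) h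
        rw [div_mul_eq_mul_div, le_div_iff₀ hp2]
        linarith) htouch
    rwa [mul_div_cancel₀ _ hp2.ne'] at this

theorem IsGameLimit.isViscositySolution (hn : 1 ≤ n) (hp : 2 < p) (hγ : 0 ≤ γ) {u : E n → ℝ}
    (hu : IsGameLimit Ω p γ u) : IsViscositySolution Ω p (2 * (p + n) * γ) u where
  continuousOn := hu.continuousOn
  above _ _ hx₀ hφ heq hle := hu.above hn hp hγ hx₀ hφ heq hle
  below φ x₀ hx₀ hφ heq hle := by
    have h := hu.neg.above hn hp hγ hx₀ (φ := fun x => -φ x) hφ.neg (by rw [heq])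
      (hle.mono fun x hx => neg_le_neg hx)
    rw [gradient_fun_neg, normPLaplacian_fun_neg, laplacian_fun_neg, hessian_fun_neg, smul_neg,
      lambdaMax_neg] at h
    refine ⟨fun hξ => ?_, fun hξ => ?_⟩
    · linarith [h.1 (neg_ne_zero.mpr hξ)]
    · linarith [h.2 (neg_eq_zero.mpr hξ)]

theorem exists_convergent_subsequence (hn : 1 ≤ n) (hp : 2 < p) (hγ : 0 ≤ γ) (hΩo : IsOpen Ω)
    (hne : Ω.Nonempty) (hΩb : Bornology.IsBounded Ω) (hΩs : ExteriorSphere Ω)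
    {ε₀ L : ℝ} (hε₀ : 0 < ε₀) {F : E n → ℝ}
    (hL : ∀ x ∈ strip Ω ε₀, ∀ z ∈ strip Ω ε₀, |F x - F z| ≤ L * ‖x - z‖)
    {v : ℕ → E n → ℝ} {e : ℕ → ℝ} (he : ∀ k, 0 < e k) (he₀ : ∀ k, e k ≤ ε₀)
    (hγe : ∀ k, γ * e k ^ 2 < 1 / 2) (hlim : Tendsto e atTop (𝓝 0))
    (hv : ∀ k, IsDPPSolution Ω p γ (e k) F (v k)) :
    ∃ (u : E n → ℝ) (s : ℕ → ℕ), StrictMono s ∧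
      TendstoUniformlyOn (fun k => v (s k)) u atTop (closure Ω) ∧
      ContinuousOn u (closure Ω) ∧ (∀ x ∈ frontier Ω, u x = F x) ∧
      IsViscositySolution Ω p (2 * (p + n) * γ) u := by
  have hfn := frontier_nonempty_of_isBounded hn hne hΩb
  obtain ⟨M, hM0, hM⟩ := exists_bound_on_strip hfn hΩb hL
  obtain ⟨u, s, hs, hunif, hcont⟩ := exists_subseq_tendstoUniformlyOn hΩb.isCompact_closure
    hne.closure (f := v) (M := M)
    (fun k x hx => (hv k).abs_le_of_boundary hn hp hγ (he k) (hγe k) hΩo hΩb hM0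
      (fun x hx => hM x (strip_mono (he₀ k) hx)) (closure_subset_union_strip hΩo (he k).le hx))
    (fun η hη => by
      obtain ⟨r, hr, ε₁, hε₁, h⟩ := equicontinuity (γ := γ) hn hp hγ hΩo hΩb hΩs hfn hε₀ hL hη
      obtain ⟨N, hN⟩ := eventually_atTop.mp (hlim.eventually_lt_const hε₁)
      exact ⟨r, hr, N, fun k hk => h (e k) (v k) (he k) (hN k hk) (he₀ k) (hγe k) (hv k)⟩)
  refine ⟨u, s, hs, hunif, hcont, fun x hx => ?_, IsGameLimit.isViscositySolution hn hp hγ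
    ⟨hΩo, hcont.mono subset_closure, fun τ hτ => ?_⟩⟩
  · refine tendsto_nhds_unique (hunif.tendsto_at (frontier_subset_closure hx)) ?_
    refine tendsto_const_nhds.congr fun k => ?_
    exact ((hv (s k)).boundary x (frontier_subset_strip hΩo (he (s k)).le hx)).symm
  · have hlim' : Tendsto (fun k => e (s k)) atTop (𝓝 0) := hlim.comp hs.tendsto_atTop
    have hsq : Tendsto (fun k => γ * e (s k) ^ 2) atTop (𝓝 0) := by
      simpa using (hlim'.pow 2).const_mul γ
    obtain ⟨k, h1, h2, h3⟩ := ((hlim'.eventually_lt_const hτ).and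
      ((hsq.eventually_lt_const hτ).and (Metric.tendstoUniformlyOn_iff.mp hunif τ hτ))).exists
    refine ⟨e (s k), F, v (s k), he _, h1, h2, hv _, fun x hx => ?_⟩
    rw [← Real.dist_eq, dist_comm]
    exact h3 x hx

end Limit

end DiscountedTugOfWar

end

theorem mainTheorem3 (n : ℕ) (hn : 1 ≤ n) (p γ : ℝ) (hp : 2 < p) (hγ : 0 ≤ γ)
    (Ω : Set (DiscountedTugOfWar.E n)) (hΩo : IsOpen Ω) (hΩc : IsConnected Ω)
    (hΩb : Bornology.IsBounded Ω) (hΩs : DiscountedTugOfWar.ExteriorSphere Ω)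
    (ε₀ : ℝ) (hε₀ : 0 < ε₀)
    (F : DiscountedTugOfWar.E n → ℝ)
    (hF : ContDiffOn ℝ 1 F (DiscountedTugOfWar.strip Ω ε₀))
    (L : ℝ) (hL : ∀ x ∈ DiscountedTugOfWar.strip Ω ε₀, ∀ z ∈ DiscountedTugOfWar.strip Ω ε₀,
      |F x - F z| ≤ L * ‖x - z‖)
    (v : ℝ → DiscountedTugOfWar.E n → ℝ)
    (hv : ∀ ε : ℝ, 0 < ε → ε ≤ ε₀ → γ * ε ^ 2 < 1 / 2 →
      DiscountedTugOfWar.IsDPPSolution Ω p γ ε F (v ε))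
    (e : ℕ → ℝ) (he : ∀ k, 0 < e k) (he₀ : ∀ k, e k ≤ ε₀) (hlim : Tendsto e atTop (𝓝 0)) :
    ∃ (u : DiscountedTugOfWar.E n → ℝ) (s : ℕ → ℕ), StrictMono s ∧
      TendstoUniformlyOn (fun k => v (e (s k))) u atTop (closure Ω) ∧
      ContinuousOn u (closure Ω) ∧
      (∀ x ∈ frontier Ω, u x = F x) ∧
      DiscountedTugOfWar.IsViscositySolution Ω p (2 * (p + n) * γ) u := by
  have hsq : Tendsto (fun k => γ * e k ^ 2) atTop (𝓝 0) := by
    simpa using (hlim.pow 2).const_mul γ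
  -- The functions `v (e k)` are known to be solutions only once `γ (e k)² < 1/2`, so finitely many
  -- terms are dropped and the subsequence is shifted by `N`.
  obtain ⟨N, hN⟩ := eventually_atTop.mp (hsq.eventually_lt_const (by norm_num : (0 : ℝ) < 1 / 2))
  have hγe : ∀ k, γ * e (k + N) ^ 2 < 1 / 2 := fun k => hN _ (Nat.le_add_left N k)
  obtain ⟨u, s, hs, h⟩ := DiscountedTugOfWar.exists_convergent_subsequence hn hp hγ hΩo
    hΩc.nonempty hΩb hΩs hε₀ hL (v := fun k => v (e (k + N))) (fun k => he (k + N))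
    (fun k => he₀ (k + N)) hγe (hlim.comp (tendsto_add_atTop_nat N))
    (fun k => hv _ (he _) (he₀ _) (hγe k))
  exact ⟨u, fun k => s k + N, fun a b hab => Nat.add_lt_add_right (hs hab) N, h⟩
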